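/- For integers $n,d\ge 0$ and real $\ell$, let $\mathcal{A}_{n,d,\ell}$ be the family of graphs on $n$ vertices with maximum degree at most $d$ that can be obtained from a single vertex by successively either adding a new vertex and joining it by an edge to an existing one, or connecting two distinct existing vertices by a path of length at least $\ell$ whose interior vertices are new. A graph $G$ is an $\varepsilon$-expander if there is an edge between every two disjoint sets of at least $\varepsilon|G|$ vertices each. Let $G^k$ be the graph on $V(G)$ in which two distinct vertices are adjacent if their distance in $G$ is at most $k$, and let $\log$ denote the logarithm to base $2$. There is an absolute constant $\varepsilon_0>0$ such that for all integers $s,t,d\ge 0$ there is $k_0=k_0(s,t,d)$ such that for every integer $k\ge k_0$ there is $\alpha_0=\alpha_0(s,t,d,k)$ such that the following holds for every real $\alpha\ge\alpha_0$, every $0<\varepsilon\le\varepsilon_0$ and every integer $n\ge 0$. Let $G$ be an $\varepsilon$-expander on $\alpha n$ vertices (so $\alpha n$ is an integer), and let $H$ be a bipartite graph in $\mathcal{A}_{n,d,2\log(\alpha n)}$. Then $$G^k\to\bigl(K_t,\,\underbrace{H,\ldots,H}_{s}\bigr),$$ that is, every colouring of the edges of $G^k$ with $s+1$ colours, the first of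 which is called grey, contains a grey copy of $K_t$ or a monochromatic copy of $H$ in one of the other $s$ colours. -/

import Mathlib

namespace ExpanderRamsey

universe u v

/-- An `ε`-expander: there is an edge between any two disjoint sets of at least `ε |G|` vertices. -/
def IsExpander {V : Type u} [Fintype V] (G : SimpleGraph V) (ε : ℝ) : Prop :=
  ∀ A B : Finset V, Disjoint A B →
    ε * (Fintype.card V : ℝ) ≤ (A.card : ℝ) → ε * (Fintype.card V : ℝ) ≤ (B.card : ℝ) →
    ∃ a ∈ A, ∃ b ∈ B, G.Adj a b

/-- The `k`-th power of `G`: distinct vertices are adjacent when their distance in `G` is at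
most `k`. The extended distance is used, so that vertices in different components are at
distance `⊤`. -/
def power {V : Type u} (G : SimpleGraph V) (k : ℕ) : SimpleGraph V where
  Adj x y := x ≠ y ∧ G.edist x y ≤ (k : ℕ∞)
  symm := ⟨fun x y h => ⟨h.1.symm, by rw [SimpleGraph.edist_comm]; exact h.2⟩⟩
  loopless := ⟨fun _ h => h.1 rfl⟩

/-- `Built ℓ S`: the subgraph `S` of `H` can be obtained from a single vertex by successively
either adding a new vertex and joining it by an edge to an existing one, or connecting two
(distinct) existing vertices by a path of length at least `ℓ` whose interior vertices are new. -/
inductive Built {V : Type u} {H : SimpleGraph V} (ℓ : ℝ) : H.Subgraph → Prop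
  | single (x : V) : Built ℓ (H.singletonSubgraph x)
  | addLeaf (S : H.Subgraph) (x y : V) (hS : Built ℓ S) (hx : x ∈ S.verts) (hy : y ∉ S.verts)
      (hxy : H.Adj x y) : Built ℓ (S ⊔ H.subgraphOfAdj hxy)
  | addPath (S : H.Subgraph) (x y : V) (hS : Built ℓ S) (hx : x ∈ S.verts) (hy : y ∈ S.verts)
      (hne : x ≠ y) (p : H.Walk x y) (hp : p.IsPath) (hlen : ℓ ≤ (p.length : ℝ))
      (hint : ∀ z ∈ p.support, z ≠ x → z ≠ y → z ∉ S.verts) : Built ℓ (S ⊔ p.toSubgraph)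

/-- The family `𝒜_{n,d,ℓ}`: graphs on `n` vertices, of maximum degree at most `d`, that can be
built from a single vertex by adding pendant edges and paths of length at least `ℓ`. -/
def InFamily {W : Type v} [Fintype W] (n d : ℕ) (ℓ : ℝ) (H : SimpleGraph W) : Prop :=
  Fintype.card W = n ∧ (∀ x : W, (H.neighborSet x).ncard ≤ d) ∧ Built ℓ (⊤ : H.Subgraph)

/-- `G → (K_t, H, …, H)` with `s` copies of `H`: in every colouring of the edges of `G` with the
`s + 1` colours `0, …, s` there is a copy of `K_t` in the colour `0` (grey), or a copy of `H` in
one of the other `s` colours. -/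
def Arrows {V : Type u} {W : Type v} (G : SimpleGraph V) (t s : ℕ) (H : SimpleGraph W) : Prop :=
  ∀ C : G.EdgeLabeling (Fin (s + 1)),
    (SimpleGraph.completeGraph (Fin t)).IsContained (C.labelGraph 0) ∨
      ∃ i : Fin s, H.IsContained (C.labelGraph i.succ)

end ExpanderRamsey

/-! Write `N = |G| = αn`. Start with `t` disjoint vertex sets of size linear in `N`. For each pair
of sets and each non-grey colour, either that colour contains `H`, or the two sets can be shrunk by
a constant factor so that no edge of that colour runs between them (`isContained_or_exists_no_adj`).
If `H` never appears, treating all pairs and colours leaves `t` linear-sized sets with only grey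
edges of `G^k` between them (`isContained_or_exists_family`). By expansion some vertex `v` of `G` is
within a bounded distance of all `t` sets (`exists_close_vertex`). One vertex of each set near `v`
gives `t` vertices pairwise at distance at most `k`, hence a grey `K_t`. The number of steps depends
only on `s`, `t`, `d`.

The core is the dichotomy. If shrinking fails, the bipartite graph `Γ` between the two sets has an
edge between any two subsets of size `κ` on opposite sides, and `H` is embedded in it by the
Friedman–Pippenger method with rollback. A Hall-type condition for small sets (`Extendable`) records
how many new neighbours each vertex can still receive. It survives attaching a suitable leaf
(`Extendable.exists_leaf`) and deleting attached leaves (`Extendable.rollback`). Pendant edges of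
`H` are single leaf steps. For a long path, binary trees of logarithmic depth are grown from its two
ends, an edge between their leaf sets is found, and everything off the resulting path is rolled back
(`State.exists_path`). This is why the paths must have length about `2 log N`. The 2-colourings take
care of parity. -/

namespace ExpanderRamsey

/-! ### Extendability: attaching and removing leaves -/

section Extendability

open Finset
open scoped Classical

variable {V : Type*} [Fintype V]

/-- The set of vertices with a neighbour in `X`. -/
noncomputable def nbr (Γ : SimpleGraph V) (X : Finset V) : Finset V :=
  univ.filter fun v => ∃ x ∈ X, Γ.Adj x v

theorem mem_nbr {Γ : SimpleGraph V} {X : Finset V} {v : V} :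
    v ∈ nbr Γ X ↔ ∃ x ∈ X, Γ.Adj x v := by simp [nbr]

theorem nbr_mono (Γ : SimpleGraph V) {X Y : Finset V} (h : X ⊆ Y) : nbr Γ X ⊆ nbr Γ Y := by
  intro v hv
  obtain ⟨x, hx, hxv⟩ := mem_nbr.1 hv
  exact mem_nbr.2 ⟨x, h hx, hxv⟩

theorem nbr_union (Γ : SimpleGraph V) (X Y : Finset V) :
    nbr Γ (X ∪ Y) = nbr Γ X ∪ nbr Γ Y := by
  ext v
  simp only [mem_nbr, mem_union, or_and_right, exists_or]

theorem nbr_empty (Γ : SimpleGraph V) : nbr Γ ∅ = ∅ := by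
  ext v
  simp [mem_nbr]

/-- Submodularity of the neighbourhood size, which makes tight sets closed under union. -/
theorem card_nbr_union_add_inter (Γ : SimpleGraph V) (F X Y : Finset V) :
    #(nbr Γ (X ∪ Y) \ F) + #(nbr Γ (X ∩ Y) \ F) ≤ #(nbr Γ X \ F) + #(nbr Γ Y \ F) := by
  rw [nbr_union, union_sdiff_distrib, ← card_union_add_card_inter (nbr Γ X \ F)]
  gcongr
  intro v hv
  simp only [mem_inter, mem_sdiff] at hv ⊢
  exact ⟨⟨nbr_mono Γ inter_subset_left hv.1, hv.2⟩, ⟨nbr_mono Γ inter_subset_right hv.1, hv.2⟩⟩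

/-- A set `F` of used vertices and a demand `r` for new neighbours at each vertex satisfy a Hall
type condition for all sets of at most `M` vertices. -/
def Extendable (Γ : SimpleGraph V) (M : ℕ) (F : Finset V) (r : V → ℕ) : Prop :=
  ∀ X : Finset V, #X ≤ M → ∑ x ∈ X, r x ≤ #(nbr Γ X \ F)

theorem Extendable.mono {Γ : SimpleGraph V} {M : ℕ} {F : Finset V} {r r' : V → ℕ}
    (h : Extendable Γ M F r) (hr : ∀ v, r' v ≤ r v) : Extendable Γ M F r' :=
  fun X hX => (sum_le_sum fun x _ => hr x).trans (h X hX)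

/-- Removing a set `T` of used vertices, and giving each its edge back to its parent. -/
theorem Extendable.rollback {Γ : SimpleGraph V} {M : ℕ} {F : Finset V} {r : V → ℕ}
    (h : Extendable Γ M F r) {T : Finset V} (hT : T ⊆ F) {par : V → V}
    (hpar : ∀ y ∈ T, Γ.Adj (par y) y) :
    Extendable Γ M (F \ T) (fun v => r v + #{y ∈ T | par y = v}) := by
  intro X hX
  have hfib : ∑ v ∈ X, #{y ∈ T | par y = v} = #{y ∈ T | par y ∈ X} := by
    convert sum_card_fiberwise_eq_card_filter T X par
  rw [sum_add_distrib, hfib]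
  refine (Nat.add_le_add_right (h X hX) _).trans ?_
  rw [← card_union_of_disjoint]
  · refine card_le_card fun v hv => ?_
    simp only [mem_union, mem_sdiff, mem_filter] at hv ⊢
    rcases hv with hv | hv
    · exact ⟨hv.1, fun h => hv.2 h.1⟩
    · exact ⟨mem_nbr.2 ⟨par v, hv.2, hpar v hv.1⟩, fun h => h.2 hv.1⟩
  · rw [disjoint_left]
    intro v hv hv'
    exact (mem_sdiff.1 hv).2 (hT (mem_filter.1 hv').1)

/-- A new leaf can be attached to any vertex with positive demand. -/
theorem Extendable.exists_leaf {Γ : SimpleGraph V} {μ : ℕ} {F : Finset V} {r : V → ℕ}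
    (hμ : 0 < μ) (h : Extendable Γ (2 * μ) F r)
    (hbig : ∀ X : Finset V, μ ≤ #X → #X ≤ 2 * μ → ∑ x ∈ X, r x < #(nbr Γ X \ F))
    {s : V} (hs : 0 < r s) :
    ∃ y ∉ F, Γ.Adj s y ∧ Extendable Γ (2 * μ) (insert y F) (r - Pi.single s 1) := by
  by_contra! hcon
  -- A blocked neighbour `y` of `s` lies in `nbr Γ X` for a set `X` avoiding `s` whose demand is
  -- exactly met. By `hbig` such sets have fewer than `μ` elements, so a union of two is still
  -- within the range `2 * μ` and is tight by submodularity.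
  let Tight : Finset V → Prop := fun X =>
    #X < μ ∧ s ∉ X ∧ #(nbr Γ X \ F) ≤ ∑ x ∈ X, r x
  have hempty : Tight ∅ := by simp [Tight, nbr_empty, hμ]
  have hunion : ∀ X Y, Tight X → Tight Y → Tight (X ∪ Y) := by
    rintro X Y ⟨hX, hsX, hX'⟩ ⟨hY, hsY, hY'⟩
    have hcard : #(X ∪ Y) ≤ 2 * μ := (card_union_le X Y).trans (by omega)
    have h1 := card_nbr_union_add_inter Γ F X Y
    have h2 := sum_union_inter (s₁ := X) (s₂ := Y) (f := r)
    have h3 := h (X ∩ Y) ((card_le_card inter_subset_left).trans (by omega))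
    have h4 : #(nbr Γ (X ∪ Y) \ F) ≤ ∑ x ∈ X ∪ Y, r x := by omega
    refine ⟨?_, by simp [hsX, hsY], h4⟩
    by_contra hlt
    exact absurd (hbig _ (not_lt.1 hlt) hcard) (by omega)
  have hone : ∀ y ∈ nbr Γ {s} \ F, ∃ X, Tight X ∧ y ∈ nbr Γ X := by
    intro y hy
    obtain ⟨hy, hyF⟩ := mem_sdiff.1 hy
    have hsy : Γ.Adj s y := by simpa [mem_nbr] using hy
    have hX := hcon y hyF hsy
    simp only [Extendable, not_forall, not_le] at hX
    obtain ⟨X, hX, hlt⟩ := hX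
    have hg := h X hX
    have hle : ∑ x ∈ X, (r - Pi.single s 1 : V → ℕ) x ≤ ∑ x ∈ X, r x :=
      sum_le_sum fun x _ => Nat.sub_le _ _
    have hsd : nbr Γ X \ insert y F = (nbr Γ X \ F).erase y := by
      ext v
      simp only [mem_sdiff, mem_insert, mem_erase]
      tauto
    rw [hsd] at hlt
    have hyX : y ∈ nbr Γ X := by
      by_contra hyX
      rw [erase_eq_of_notMem (fun h => hyX (mem_sdiff.1 h).1)] at hlt
      omega
    have hcy := card_erase_add_one (mem_sdiff.2 ⟨hyX, hyF⟩ : y ∈ nbr Γ X \ F)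
    have hsX : s ∉ X := by
      intro hsX
      have : ∑ x ∈ X, (r - Pi.single s 1 : V → ℕ) x < ∑ x ∈ X, r x :=
        sum_lt_sum (fun x _ => Nat.sub_le _ _) ⟨s, hsX, by simp; omega⟩
      omega
    refine ⟨X, ⟨?_, hsX, by omega⟩, hyX⟩
    by_contra hlt'
    have := hbig X (not_lt.1 hlt') hX
    omega
  have hall : ∀ J : Finset V, J ⊆ nbr Γ {s} \ F → ∃ X, Tight X ∧ J ⊆ nbr Γ X := by
    intro J
    induction J using Finset.induction with
    | empty => exact fun _ => ⟨∅, hempty, by simp⟩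
    | insert y J hy ih =>
      intro hJ
      obtain ⟨X, hX, hJX⟩ := ih ((subset_insert y J).trans hJ)
      obtain ⟨Y, hY, hyY⟩ := hone y (hJ (mem_insert_self y J))
      refine ⟨X ∪ Y, hunion X Y hX hY, ?_⟩
      rw [nbr_union]
      exact insert_subset (mem_union_right _ hyY) (hJX.trans subset_union_left)
  -- One tight `X` now covers all free neighbours of `s`. Adding `s` to it raises the demand by `r s
  -- > 0` but gains no neighbour.
  obtain ⟨X, ⟨hX, hsX, htight⟩, hsub⟩ := hall _ subset_rfl
  have h1 := h (insert s X) ((card_insert_le s X).trans (by omega))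
  rw [sum_insert hsX] at h1
  have h2 : nbr Γ (insert s X) \ F ⊆ nbr Γ X \ F := by
    rw [insert_eq, nbr_union, union_sdiff_distrib]
    exact union_subset (subset_sdiff.2 ⟨hsub, disjoint_sdiff_self_left⟩) subset_rfl
  have h3 := card_le_card h2
  omega

/-- Deleting a largest non-expanding set leaves a graph in which small sets expand. -/
theorem exists_core (Γ : SimpleGraph V) {μ q : ℕ}
    (h : ∀ X : Finset V, μ ≤ #X → #X ≤ 2 * μ → q * #X < #(nbr Γ X \ X)) :
    ∃ Z : Finset V, #Z < μ ∧ ∀ X : Finset V, Disjoint X Z → X.Nonempty → #X ≤ μ →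
      q * #X < #(nbr Γ X \ (Z ∪ X)) := by
  obtain ⟨Z, hZ, hmax⟩ := exists_max_image
    (univ.filter fun Z : Finset V => #Z ≤ 2 * μ ∧ #(nbr Γ Z \ Z) ≤ q * #Z) card
    ⟨∅, by simp [nbr_empty]⟩
  simp only [mem_filter, mem_univ, true_and] at hZ hmax
  have hZμ : #Z < μ := by
    by_contra hlt
    have := h Z (not_lt.1 hlt) hZ.1
    omega
  refine ⟨Z, hZμ, fun X hXZ hne hX => ?_⟩
  by_contra! hlt
  have hcard := card_union_of_disjoint hXZ.symm
  have hpos := hne.card_pos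
  have hsub : nbr Γ (Z ∪ X) \ (Z ∪ X) ⊆ (nbr Γ Z \ Z) ∪ (nbr Γ X \ (Z ∪ X)) := by
    intro v hv
    simp only [nbr_union, mem_sdiff, mem_union] at hv ⊢
    tauto
  have h1 := (card_le_card hsub).trans (card_union_le _ _)
  have h2 := hmax (Z ∪ X) ⟨by omega, by rw [hcard, mul_add]; omega⟩
  omega

/-- Every set of between `μ` and `2μ` vertices has more than `f + q |X|` neighbours. -/
def Roomy (Γ : SimpleGraph V) (μ q f : ℕ) : Prop :=
  ∀ X : Finset V, μ ≤ #X → #X ≤ 2 * μ → f + q * #X < #(nbr Γ X)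

theorem Roomy.sum_lt {Γ : SimpleGraph V} {μ q f : ℕ} (h : Roomy Γ μ q f) {F : Finset V}
    (hF : #F ≤ f) {r : V → ℕ} (hr : ∀ v, r v ≤ q) (X : Finset V) (h1 : μ ≤ #X)
    (h2 : #X ≤ 2 * μ) : ∑ x ∈ X, r x < #(nbr Γ X \ F) := by
  have h3 := h X h1 h2
  have h4 : ∑ x ∈ X, r x ≤ #X • q := sum_le_card_nsmul X r q fun x _ => hr x
  have h5 := le_card_sdiff F (nbr Γ X)
  rw [smul_eq_mul, mul_comm] at h4
  omega

/-- The core `Z` is declared used with demand `0`. Small sets outside it have strictly more than `q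
* #X` free neighbours, and this strictness pays for the starting vertex `v`; larger sets are handled
by roominess. -/
theorem Roomy.exists_initial {Γ : SimpleGraph V} {μ q f : ℕ} (h : Roomy Γ μ q f)
    (hf : 2 * μ ≤ f) :
    ∃ Z : Finset V, #Z < μ ∧
      ∀ v, Extendable Γ (2 * μ) (insert v Z) (fun u => if u ∈ Z then 0 else q) := by
  obtain ⟨Z, hZ, hcore⟩ := exists_core Γ (q := q) fun X h1 h2 => by
    have := h X h1 h2
    have := le_card_sdiff X (nbr Γ X)
    omega
  refine ⟨Z, hZ, fun v X hX => ?_⟩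
  have hsum : ∑ x ∈ X, (if x ∈ Z then 0 else q) = q * #(X \ Z) := by
    rw [sum_ite, sum_const_zero, zero_add, sum_const, smul_eq_mul, mul_comm, filter_notMem_eq_sdiff]
  rw [hsum]
  have hXZ : #(X \ Z) ≤ #X := card_le_card sdiff_subset
  have hsub : #(nbr Γ (X \ Z) \ Z) ≤ #(nbr Γ X \ Z) :=
    card_le_card (sdiff_subset_sdiff (nbr_mono Γ sdiff_subset) subset_rfl)
  have herase : #(nbr Γ X \ Z) ≤ #(nbr Γ X \ insert v Z) + 1 := by
    rw [sdiff_insert]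
    exact Nat.sub_le_iff_le_add.1 pred_card_le_card_erase
  rcases (X \ Z).eq_empty_or_nonempty with he | hne
  · simp [he]
  refine Nat.lt_succ_iff.1 (lt_of_lt_of_le ?_ (hsub.trans herase))
  rcases le_total (#(X \ Z)) μ with hle | hle
  · refine (hcore _ disjoint_sdiff_self_left hne hle).trans_le (card_le_card ?_)
    exact sdiff_subset_sdiff subset_rfl subset_union_left
  · have := h.sum_lt (F := Z) (by omega) (r := fun _ => q) (fun _ => le_rfl) _ hle (by omega)
    rwa [sum_const, smul_eq_mul, mul_comm] at this

end Extendability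

/-! ### Connecting two used vertices by a path -/

section Connecting

open Finset
open scoped Classical

variable {V : Type*} [Fintype V]

/-- An extendable state in which every unused vertex has full demand `q`. -/
structure State (Γ : SimpleGraph V) (μ q : ℕ) (F : Finset V) (r : V → ℕ) : Prop where
  ext : Extendable Γ (2 * μ) F r
  le : ∀ v, r v ≤ q
  eq : ∀ v ∉ F, r v = q

theorem State.exists_leaf {Γ : SimpleGraph V} {μ q f : ℕ} (hμ : 0 < μ) (hroom : Roomy Γ μ q f)
    {F : Finset V} {r : V → ℕ} (h : State Γ μ q F r) (hF : #F ≤ f) {s : V} (hsF : s ∈ F)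
    (hs : 0 < r s) :
    ∃ y ∉ F, Γ.Adj s y ∧ State Γ μ q (insert y F) (r - Pi.single s 1) := by
  obtain ⟨y, hy, hsy, hext⟩ := h.ext.exists_leaf hμ (hroom.sum_lt hF h.le) hs
  refine ⟨y, hy, hsy, hext, fun v => (Nat.sub_le _ _).trans (h.le v), fun v hv => ?_⟩
  rw [mem_insert, not_or] at hv
  have hvs : v ≠ s := fun e => hv.2 (e ▸ hsF)
  simp [hvs, h.eq v hv.2]

/-- The number of children of `v` in `T` for the parent function `par`. -/
noncomputable def kids (T : Finset V) (par : V → V) (v : V) : ℕ := #{y ∈ T | par y = v}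

omit [Fintype V] in
theorem kids_union {T T' : Finset V} (h : Disjoint T T') (par : V → V) (v : V) :
    kids (T ∪ T') par v = kids T par v + kids T' par v := by
  rw [kids, filter_union, card_union_of_disjoint (disjoint_filter_filter h), kids, kids]

omit [Fintype V] in
theorem kids_congr {T : Finset V} {par par' : V → V} (h : ∀ y ∈ T, par y = par' y) (v : V) :
    kids T par v = kids T par' v := by
  rw [kids, kids, filter_congr fun y hy => by rw [h y hy]]

omit [Fintype V] in
theorem kids_pos {T : Finset V} {par : V → V} {y : V} (hy : y ∈ T) : 0 < kids T par (par y) :=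
  card_pos.2 ⟨y, mem_filter.2 ⟨hy, rfl⟩⟩

omit [Fintype V] in
theorem kids_sdiff {T P : Finset V} (h : P ⊆ T) (par : V → V) (v : V) :
    kids T par v = kids P par v + kids (T \ P) par v := by
  rw [← kids_union disjoint_sdiff, union_sdiff_of_subset h]

/-- Any demand `g ≤ r` on used vertices can be met by new leaves. -/
theorem State.exists_leaves {Γ : SimpleGraph V} {μ q f : ℕ} (hμ : 0 < μ)
    (hroom : Roomy Γ μ q f) (m : ℕ) {F : Finset V} {r g : V → ℕ} (h : State Γ μ q F r)
    (hg : ∀ v, g v ≤ r v) (hgF : ∀ v ∉ F, g v = 0) (hm : ∑ v, g v = m) (hF : #F + m ≤ f) :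
    ∃ (T : Finset V) (par : V → V), Disjoint T F ∧ #T = m ∧ (∀ y ∈ T, Γ.Adj (par y) y) ∧
      (∀ v, kids T par v = g v) ∧ State Γ μ q (F ∪ T) (r - g) := by
  induction m generalizing F r g with
  | zero =>
    have hg0 : g = 0 := by
      ext v
      exact (sum_eq_zero_iff.1 hm) v (mem_univ v)
    subst hg0
    exact ⟨∅, id, by simp, by simp, by simp, by simp [kids], by simpa using h⟩
  | succ m ih =>
    obtain ⟨s, -, hs⟩ : ∃ s ∈ univ, 0 < g s := by
      by_contra! hcon
      have : ∑ v, g v = 0 := sum_eq_zero fun v hv => Nat.le_zero.1 (hcon v hv)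
      omega
    have hsF : s ∈ F := by
      by_contra hsF
      have := hgF s hsF
      omega
    obtain ⟨y, hy, hsy, hst⟩ :=
      h.exists_leaf hμ hroom (by omega) hsF (lt_of_lt_of_le hs (hg s))
    have hsum : ∑ v, (g - Pi.single s 1 : V → ℕ) v = m := by
      have h1 : ∑ v, g v = ∑ v, (g - Pi.single s 1 : V → ℕ) v + ∑ v, (Pi.single s 1 : V → ℕ) v := by
        rw [← sum_add_distrib]
        refine sum_congr rfl fun v _ => ?_
        by_cases hv : v = s
        · subst hv
          simp
          omega
        · simp [hv]
      rw [sum_pi_single'] at h1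
      simp at h1
      simp
      omega
    obtain ⟨T, par, hTF, hT, hadj, hkids, hst'⟩ := ih hst (g := g - Pi.single s 1)
      (fun v => by have := hg v; simp only [Pi.sub_apply]; omega)
      (fun v hv => by
        have := hgF v (fun h => hv (mem_insert_of_mem h))
        simp only [Pi.sub_apply]; omega) hsum
      (by rw [card_insert_of_notMem hy]; omega)
    rw [disjoint_insert_right] at hTF
    refine ⟨insert y T, fun v => if v = y then s else par v, ?_, ?_, ?_, ?_, ?_⟩
    · rw [disjoint_insert_left]
      exact ⟨hy, hTF.2⟩
    · rw [card_insert_of_notMem hTF.1, hT]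
    · intro v hv
      by_cases hvy : v = y
      · subst hvy
        simpa using hsy
      · simpa [hvy] using hadj v ((mem_insert.1 hv).resolve_left hvy)
    · intro v
      rw [insert_eq, kids_union (disjoint_singleton_left.2 hTF.1),
        kids_congr (T := T) (par' := par), hkids]
      · by_cases hv : v = s
        · subst hv
          simp [kids, filter_singleton]
          omega
        · simp [kids, filter_singleton, hv, Ne.symm hv]
      · intro z hz
        have : z ≠ y := fun e => hTF.1 (e ▸ hz)
        simp [this]
    · have hr : r - Pi.single s 1 - (g - Pi.single s 1) = r - g := by
        ext v
        by_cases hv : v = s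
        · subst hv
          simp
          omega
        · simp [hv]
      rw [hr, insert_union] at hst'
      rwa [union_insert]

/-- A binary tree with `2 ^ j` leaves below a single child of `a`. -/
theorem State.exists_tree {Γ : SimpleGraph V} {μ q f : ℕ} (hμ : 0 < μ) (hq : 2 ≤ q)
    (hroom : Roomy Γ μ q f) (j : ℕ) {F : Finset V} {r : V → ℕ} (h : State Γ μ q F r) {a : V}
    (ha : a ∈ F) (hra : 0 < r a) (hF : #F + 2 ^ (j + 1) ≤ f) :
    ∃ (T E : Finset V) (par : V → V), Disjoint T F ∧ E ⊆ T ∧ #E = 2 ^ j ∧ #T < 2 ^ (j + 1) ∧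
      (∀ y ∈ T, Γ.Adj (par y) y) ∧ (∀ v, kids T par v ≤ r v) ∧ (∀ v ∈ E, kids T par v = 0) ∧
      (∀ v ∈ F, v ≠ a → kids T par v = 0) ∧
      State Γ μ q (F ∪ T) (r - kids T par) ∧
      ∀ e ∈ E, par^[j + 1] e = a ∧ ∀ i ≤ j, par^[i] e ∈ T := by
  induction j with
  | zero =>
    obtain ⟨y, hy, hay, hst⟩ := h.exists_leaf hμ hroom (by omega) ha hra
    have hk : kids {y} (fun _ => a) = Pi.single a 1 := by
      ext v
      by_cases hv : v = a
      · subst hv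
        simp [kids]
      · simp [kids, hv, Ne.symm hv]
    refine ⟨{y}, {y}, fun _ => a, by simpa using hy, subset_rfl, by simp, by simp,
      by simpa using hay, ?_, ?_, ?_, ?_, by simp⟩
    · intro v
      rw [hk]
      by_cases hv : v = a
      · subst hv
        rw [Pi.single_eq_same]
        exact hra
      · simp [hv]
    · have : y ≠ a := fun e => hy (e ▸ ha)
      simp [hk, this]
    · intro v _ hv
      simp [hk, hv]
    · rw [hk, union_comm, ← insert_eq]
      exact hst
  | succ j ih =>
    have hpow : 2 ^ (j + 1 + 1) = 2 ^ (j + 1) + 2 ^ (j + 1) := by ring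
    have hpow' : 2 ^ (j + 1) = 2 * 2 ^ j := by ring
    obtain ⟨T, E, par, hTF, hET, hE, hT, hadj, hle, hleaf, hold, hst, hiter⟩ := ih (by omega)
    have hEF : ∀ v ∈ E, v ∉ F := fun v hv => disjoint_left.1 hTF (hET hv)
    -- The leaves in `E` were unused before and have no children, so each still has demand `q ≥ 2`
    -- and can receive two children.
    obtain ⟨T', par', hT'F, hT', hadj', hkids', hst'⟩ := hst.exists_leaves hμ hroom (2 ^ (j + 1))
      (g := fun v => if v ∈ E then 2 else 0)
      (by
        intro v
        by_cases hv : v ∈ E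
        · have := h.eq v (hEF v hv)
          simp [hv, hleaf v hv]
          omega
        · simp [hv])
      (by
        intro v hv
        have : v ∉ E := fun h => hv (mem_union_right _ (hET h))
        simp [this])
      (by simp [hE, hpow', mul_comm])
      (by rw [card_union_of_disjoint hTF.symm]; omega)
    rw [disjoint_union_right] at hT'F
    obtain ⟨hT'F, hT'T⟩ := hT'F
    have hpT : ∀ y ∈ T, (if y ∈ T' then par' y else par y) = par y := fun y hy =>
      if_neg (disjoint_right.1 hT'T hy)
    have hpT' : ∀ y ∈ T', (if y ∈ T' then par' y else par y) = par' y := fun y hy => if_pos hy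
    have hk : ∀ v, kids (T ∪ T') (fun y => if y ∈ T' then par' y else par y) v =
        kids T par v + if v ∈ E then 2 else 0 := by
      intro v
      rw [kids_union hT'T.symm, kids_congr hpT, kids_congr hpT', hkids']
    have hout : ∀ v ∉ F ∪ T, kids T par v = 0 := by
      intro v hv
      have h1 := hst.eq v hv
      have h2 := h.eq v (fun h => hv (mem_union_left _ h))
      have h3 := hle v
      simp only [Pi.sub_apply] at h1
      omega
    refine ⟨T ∪ T', T', fun y => if y ∈ T' then par' y else par y, ?_, subset_union_right, hT', ?_,
      ?_, ?_, ?_, ?_, ?_, ?_⟩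
    · rw [disjoint_union_left]
      exact ⟨hTF, hT'F⟩
    · rw [card_union_of_disjoint hT'T.symm]
      omega
    · intro y hy
      rcases mem_union.1 hy with hy | hy
      · simpa only [hpT y hy] using hadj y hy
      · simpa only [hpT' y hy] using hadj' y hy
    · intro v
      rw [hk]
      by_cases hv : v ∈ E
      · have := h.eq v (hEF v hv)
        simp [hv, hleaf v hv]
        omega
      · simpa [hv] using hle v
    · intro v hv
      have hvT : v ∉ T := disjoint_left.1 hT'T hv
      have hvE : v ∉ E := fun h => hvT (hET h)
      rw [hk, hout v (by simp [hvT, disjoint_left.1 hT'F hv])]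
      simp [hvE]
    · intro v hv hva
      have hvE : v ∉ E := fun h => hEF v h hv
      rw [hk, hold v hv hva]
      simp [hvE]
    · have hr : r - kids (T ∪ T') (fun y => if y ∈ T' then par' y else par y) =
          r - kids T par - fun v => if v ∈ E then 2 else 0 := by
        ext v
        simp only [Pi.sub_apply, hk]
        omega
      rw [hr, ← union_assoc]
      exact hst'
    · intro e he
      have hpe : par' e ∈ E := by
        have := kids_pos (par := par') he
        rw [hkids'] at this
        by_contra hcon
        simp [hcon] at this
      obtain ⟨hroot, hmem⟩ := hiter _ hpe
      have hit : ∀ i ≤ j + 1, (fun y => if y ∈ T' then par' y else par y)^[i] (par' e) =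
          par^[i] (par' e) := by
        intro i
        induction i with
        | zero => simp
        | succ i ihi =>
          intro hi
          rw [Function.iterate_succ_apply', Function.iterate_succ_apply', ihi (by omega)]
          exact hpT _ (hmem i (by omega))
      constructor
      · rw [Function.iterate_succ_apply]
        simp only [he, if_true]
        rw [hit _ le_rfl, hroot]
      · intro i hi
        cases i with
        | zero => exact mem_union_right _ he
        | succ i =>
          rw [Function.iterate_succ_apply]
          simp only [he, if_true]
          rw [hit _ (by omega)]
          exact mem_union_left _ (hmem i (by omega))

/-- The vertices of the branch from `e` to its `j`-th ancestor. -/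
noncomputable def branch (par : V → V) (j : ℕ) (e : V) : Finset V :=
  (range (j + 1)).image fun i => par^[i] e

omit [Fintype V] in
theorem mem_branch {par : V → V} {j : ℕ} {e v : V} :
    v ∈ branch par j e ↔ ∃ i ≤ j, par^[i] e = v := by
  simp [branch]

-- If two iterates coincided, moving both up until the higher one reaches the root `a` would leave
-- the other inside `T`, which does not contain `a`.
omit [Fintype V] in
theorem iterate_parent_injOn {T : Finset V} {par : V → V} {a e : V} {j : ℕ} (ha : a ∉ T)
    (hroot : par^[j + 1] e = a) (hmem : ∀ i ≤ j, par^[i] e ∈ T) {i i' : ℕ} (hi : i ≤ j + 1)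
    (hi' : i' ≤ j + 1) (h : par^[i] e = par^[i'] e) : i = i' := by
  wlog hlt : i < i' generalizing i i'
  · rcases Nat.lt_or_ge i' i with h1 | h1
    · exact (this hi' hi h.symm h1).symm
    · omega
  have h1 : par^[j + 1 - i'] (par^[i] e) = par^[j + 1 - i'] (par^[i'] e) := by rw [h]
  rw [← Function.iterate_add_apply, ← Function.iterate_add_apply,
    show j + 1 - i' + i' = j + 1 by omega, hroot] at h1
  exact absurd (h1 ▸ hmem (j + 1 - i' + i) (by omega)) ha

-- Iterates along a branch are distinct, so each vertex on it has at most one child on it. Keeping a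
-- branch therefore costs at most one unit of demand per vertex.
omit [Fintype V] in
theorem kids_branch_le {T : Finset V} {par : V → V} {a e : V} {j : ℕ} (ha : a ∉ T)
    (hroot : par^[j + 1] e = a) (hmem : ∀ i ≤ j, par^[i] e ∈ T) (v : V) :
    kids (branch par j e) par v ≤ if v ∈ insert a (branch par j e) then 1 else 0 := by
  split_ifs with hv
  · rw [kids, card_le_one]
    intro y hy z hz
    simp only [mem_filter, mem_branch] at hy hz
    obtain ⟨⟨i, hi, rfl⟩, hy⟩ := hy
    obtain ⟨⟨i', hi', rfl⟩, hz⟩ := hz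
    rw [← hz, ← Function.iterate_succ_apply' par, ← Function.iterate_succ_apply' par] at hy
    have := iterate_parent_injOn ha hroot hmem (by omega) (by omega) hy
    rw [Nat.succ_injective this]
  · rw [Nat.le_zero, kids, card_eq_zero, filter_eq_empty_iff]
    rintro y hy rfl
    obtain ⟨i, hi, rfl⟩ := mem_branch.1 hy
    apply hv
    rw [← Function.iterate_succ_apply' par, mem_insert, mem_branch]
    rcases hi.lt_or_eq with hi | rfl
    · exact Or.inr ⟨i + 1, hi, rfl⟩
    · exact Or.inl hroot

/-- Any `κ` vertices coloured `true` and any `κ` vertices coloured `false` span an edge. -/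
def Joined (Γ : SimpleGraph V) (σ : V → Bool) (κ : ℕ) : Prop :=
  ∀ X Y : Finset V, (∀ x ∈ X, σ x = true) → (∀ y ∈ Y, σ y = false) → κ ≤ #X → κ ≤ #Y →
    ∃ x ∈ X, ∃ y ∈ Y, Γ.Adj x y

omit [Fintype V] in
theorem Joined.exists_adj {Γ : SimpleGraph V} {σ : V → Bool} {κ : ℕ} (h : Joined Γ σ κ)
    {X Y : Finset V} {b : Bool} (hX : ∀ x ∈ X, σ x = b) (hY : ∀ y ∈ Y, σ y = !b) (hκX : κ ≤ #X)
    (hκY : κ ≤ #Y) : ∃ x ∈ X, ∃ y ∈ Y, Γ.Adj x y := by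
  cases b with
  | true => exact h X Y hX hY hκX hκY
  | false =>
    obtain ⟨y, hy, x, hx, hyx⟩ := h Y X hY hX hκY hκX
    exact ⟨x, hx, y, hy, hyx.symm⟩

-- Colours alternate along a branch, so all leaves at the same depth of a tree share a colour; this
-- is what lets `Joined` be applied to the leaf sets.
omit [Fintype V] in
theorem coloring_iterate_parent {Γ : SimpleGraph V} (σ : Γ.Coloring Bool) {T : Finset V}
    {par : V → V} (hadj : ∀ y ∈ T, Γ.Adj (par y) y) {e : V} {j : ℕ}
    (hmem : ∀ i ≤ j, par^[i] e ∈ T) {i : ℕ} (hi : i ≤ j + 1) :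
    σ (par^[i] e) = (σ e ^^ decide (Odd i)) := by
  induction i with
  | zero => simp
  | succ i ih =>
    have h1 := σ.valid (hadj _ (hmem i (by omega)))
    rw [← Function.iterate_succ_apply' par, ih (by omega)] at h1
    simp only [Nat.odd_add_one, decide_not, Bool.xor_not]
    exact Bool.eq_not.2 h1

omit [Fintype V] in
theorem sdiff_sdiff_branches {F T T' P P' : Finset V} {a b : V} (hTF : Disjoint T F)
    (hT'F : Disjoint T' F) (hT'T : Disjoint T' T) (hP : P ⊆ T) (hP' : P' ⊆ T') (ha : a ∈ F)
    (hb : b ∈ F) :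
    ((F ∪ T ∪ T') \ (T' \ P')) \ (T \ P) = F ∪ (insert a P ∪ insert b P') := by
  ext v
  have p1 : v ∈ P → v ∈ T := @hP v
  have p2 : v ∈ P' → v ∈ T' := @hP' v
  have p3 : v ∈ T → v ∉ F := fun h => disjoint_left.1 hTF h
  have p4 : v ∈ T' → v ∉ F := fun h => disjoint_left.1 hT'F h
  have p5 : v ∈ T' → v ∉ T := fun h => disjoint_left.1 hT'T h
  have p6 : v = a → v ∈ F := fun h => h ▸ ha
  have p7 : v = b → v ∈ F := fun h => h ▸ hb
  simp only [mem_sdiff, mem_union, mem_insert]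
  clear hTF hT'F hT'T hP hP' ha hb
  grind

/-- Two vertices of positive demand are joined by a path of length `2 j + 3` with unused interior,
if they have different colours. -/
theorem State.exists_path_aux {Γ : SimpleGraph V} {μ q f κ j : ℕ} (hμ : 0 < μ) (hq : 2 ≤ q)
    (hroom : Roomy Γ μ q f) (σ : Γ.Coloring Bool) (hjoin : Joined Γ σ κ) (hκ : κ ≤ 2 ^ j)
    {F : Finset V} {r : V → ℕ} (h : State Γ μ q F r) {a b : V} (hab : a ≠ b) (ha : a ∈ F)
    (hb : b ∈ F) (hra : 0 < r a) (hrb : 0 < r b) (hσ : σ a ≠ σ b)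
    (hF : #F + 2 * 2 ^ (j + 1) ≤ f) :
    ∃ w : ℕ → V, w 0 = a ∧ w (2 * j + 3) = b ∧ (∀ i < 2 * j + 3, Γ.Adj (w i) (w (i + 1))) ∧
      (∀ i ≤ 2 * j + 3, ∀ i' ≤ 2 * j + 3, w i = w i' → i = i') ∧
      (∀ i, 0 < i → i < 2 * j + 3 → w i ∉ F) ∧
      State Γ μ q (F ∪ (range (2 * j + 3 + 1)).image w)
        (fun v => r v - if v ∈ (range (2 * j + 3 + 1)).image w then 1 else 0) := by
  obtain ⟨T, E, par, hTF, hET, hE, hT, hadj, hle, -, hold, hst, hiter⟩ :=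
    h.exists_tree hμ hq hroom j ha hra (by omega)
  obtain ⟨T', E', par', hT'F, hET', hE', -, hadj', hle', -, -, hst', hiter'⟩ :=
    hst.exists_tree hμ hq hroom j (a := b) (mem_union_left _ hb)
      (by simp only [Pi.sub_apply, hold b hb hab.symm]; omega)
      (by rw [card_union_of_disjoint hTF.symm]; omega)
  rw [disjoint_union_right] at hT'F
  obtain ⟨hT'F, hT'T⟩ := hT'F
  have haT : a ∉ T := disjoint_right.1 hTF ha
  have hbT : b ∉ T := disjoint_right.1 hTF hb
  have haT' : a ∉ T' := disjoint_right.1 hT'F ha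
  have hbT' : b ∉ T' := disjoint_right.1 hT'F hb
  have hσE : ∀ e ∈ E, σ e = (σ a ^^ decide (Odd (j + 1))) := by
    intro e he
    have := coloring_iterate_parent σ hadj (hiter e he).2 le_rfl
    rw [(hiter e he).1] at this
    rw [this, Bool.xor_assoc, Bool.xor_self, Bool.xor_false]
  have hσE' : ∀ e ∈ E', σ e = !(σ a ^^ decide (Odd (j + 1))) := by
    intro e he
    have := coloring_iterate_parent σ hadj' (hiter' e he).2 le_rfl
    rw [(hiter' e he).1] at this
    have hba : σ a = !σ b := Bool.eq_not.2 hσ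
    rw [hba, this]
    simp
  obtain ⟨e, he, e', he', hee'⟩ := hjoin.exists_adj hσE hσE' (by omega) (by omega)
  obtain ⟨hroot, hmem⟩ := hiter e he
  obtain ⟨hroot', hmem'⟩ := hiter' e' he'
  have hPT : branch par j e ⊆ T := by
    intro v hv
    obtain ⟨i, hi, rfl⟩ := mem_branch.1 hv
    exact hmem i hi
  have hPT' : branch par' j e' ⊆ T' := by
    intro v hv
    obtain ⟨i, hi, rfl⟩ := mem_branch.1 hv
    exact hmem' i hi
  -- Down from `a` to `e` in `j + 1` steps, across the edge `e e'`, then up to `b` in `j + 1` steps: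
  -- length `2 * j + 3`.
  let w : ℕ → V := fun i => if i ≤ j + 1 then par^[j + 1 - i] e else par'^[i - (j + 2)] e'
  have hw1 : ∀ i ≤ j + 1, w i = par^[j + 1 - i] e := fun i hi => if_pos hi
  have hw2 : ∀ i, j + 1 < i → w i = par'^[i - (j + 2)] e' := fun i hi => if_neg (by omega)
  have hmem1 : ∀ i, 0 < i → i ≤ j + 1 → w i ∈ T := fun i h0 hi => by
    rw [hw1 i hi]
    exact hmem _ (by omega)
  have hmem2 : ∀ i, j + 1 < i → i < 2 * j + 3 → w i ∈ T' := fun i h0 hi => by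
    rw [hw2 i h0]
    exact hmem' _ (by omega)
  have hw0 : w 0 = a := by rw [hw1 0 (by omega)]; exact hroot
  have hwL : w (2 * j + 3) = b := by
    rw [hw2 _ (by omega), show 2 * j + 3 - (j + 2) = j + 1 by omega]
    exact hroot'
  have himage : (range (2 * j + 3 + 1)).image w =
      insert a (branch par j e) ∪ insert b (branch par' j e') := by
    ext v
    simp only [mem_image, mem_range, mem_union, mem_insert, mem_branch]
    constructor
    · rintro ⟨i, hi, rfl⟩
      rcases Nat.lt_or_ge (j + 1) i with h1 | h1
      · right
        rcases (Nat.lt_succ_iff.1 hi).lt_or_eq with h2 | rfl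
        · exact Or.inr ⟨i - (j + 2), by omega, (hw2 i h1).symm⟩
        · exact Or.inl hwL
      · left
        rcases Nat.eq_zero_or_pos i with rfl | h2
        · exact Or.inl hw0
        · exact Or.inr ⟨j + 1 - i, by omega, (hw1 i h1).symm⟩
    · rintro ((rfl | ⟨i, hi, rfl⟩) | (rfl | ⟨i, hi, rfl⟩))
      · exact ⟨0, by omega, hw0⟩
      · refine ⟨j + 1 - i, by omega, ?_⟩
        rw [hw1 _ (by omega), show j + 1 - (j + 1 - i) = i by omega]
      · exact ⟨2 * j + 3, by omega, hwL⟩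
      · refine ⟨i + (j + 2), by omega, ?_⟩
        rw [hw2 _ (by omega), Nat.add_sub_cancel]
  have hcross : ∀ v, v ∈ insert a (branch par j e) → v ∉ insert b (branch par' j e') := by
    intro v hv hv'
    rcases mem_insert.1 hv with rfl | hv <;> rcases mem_insert.1 hv' with hv' | hv'
    · exact hab hv'
    · exact haT' (hPT' hv')
    · exact hbT (hv' ▸ hPT hv)
    · exact disjoint_left.1 hT'T (hPT' hv') (hPT hv)
  refine ⟨w, hw0, hwL, ?_, ?_, ?_, ?_, ?_, ?_⟩
  · intro i hi
    rcases lt_trichotomy i (j + 1) with h1 | rfl | h1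
    · rw [hw1 i h1.le, hw1 (i + 1) h1, show j + 1 - i = j + 1 - (i + 1) + 1 by omega,
        Function.iterate_succ_apply']
      exact hadj _ (hmem _ (by omega))
    · rw [hw1 _ le_rfl, hw2 _ (by omega)]
      simpa using hee'
    · rw [hw2 i h1, hw2 (i + 1) (by omega), show i + 1 - (j + 2) = i - (j + 2) + 1 by omega,
        Function.iterate_succ_apply']
      exact (hadj' _ (hmem' _ (by omega))).symm
  · have hside1 : ∀ i ≤ j + 1, w i ∈ insert a (branch par j e) := by
      intro i hi
      rcases Nat.eq_zero_or_pos i with rfl | h2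
      · exact mem_insert.2 (Or.inl hw0)
      · exact mem_insert_of_mem (mem_branch.2 ⟨j + 1 - i, by omega, (hw1 i hi).symm⟩)
    have hside2 : ∀ i ≤ 2 * j + 3, j + 1 < i → w i ∈ insert b (branch par' j e') := by
      intro i hi h1
      rcases hi.lt_or_eq with h2 | rfl
      · exact mem_insert_of_mem (mem_branch.2 ⟨i - (j + 2), by omega, (hw2 i h1).symm⟩)
      · exact mem_insert.2 (Or.inl hwL)
    intro i hi i' hi' heq
    rcases Nat.lt_or_ge (j + 1) i with h1 | h1 <;> rcases Nat.lt_or_ge (j + 1) i' with h2 | h2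
    · rw [hw2 i h1, hw2 i' h2] at heq
      have := iterate_parent_injOn hbT' hroot' hmem' (by omega) (by omega) heq
      omega
    · exact absurd (hside2 i hi h1) (heq ▸ hcross _ (hside1 i' h2))
    · exact absurd (hside2 i' hi' h2) (heq ▸ hcross _ (hside1 i h1))
    · rw [hw1 i h1, hw1 i' h2] at heq
      have := iterate_parent_injOn haT hroot hmem (by omega) (by omega) heq
      omega
  · intro i h0 hi
    rcases Nat.lt_or_ge (j + 1) i with h1 | h1
    · exact disjoint_left.1 hT'F (hmem2 i h1 hi)
    · exact disjoint_left.1 hTF (hmem1 i h0 h1)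
  · have h1 := hst'.ext.rollback (T := T' \ branch par' j e')
      (sdiff_subset.trans subset_union_right) fun y hy => hadj' y (sdiff_subset hy)
    have h2 := h1.rollback (T := T \ branch par j e)
      (by
        intro v hv
        have hvT := sdiff_subset hv
        have hvT' : v ∉ T' := disjoint_right.1 hT'T hvT
        simp [hvT, hvT'])
      fun y hy => hadj y (sdiff_subset hy)
    have hset : ((F ∪ T ∪ T') \ (T' \ branch par' j e')) \ (T \ branch par j e) =
        F ∪ (range (2 * j + 3 + 1)).image w := by
      rw [himage]
      exact sdiff_sdiff_branches hTF hT'F hT'T hPT hPT' ha hb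
    rw [hset] at h2
    refine h2.mono fun v => ?_
    have k1 := kids_sdiff hPT par v
    have k2 := kids_sdiff hPT' par' v
    have k3 := kids_branch_le haT hroot hmem v
    have k4 := kids_branch_le hbT' hroot' hmem' v
    have k5 := hle v
    have k6 := hle' v
    have k7 := hcross v
    simp only [Pi.sub_apply] at k6 ⊢
    simp only [kids] at *
    rw [himage]
    by_cases c1 : v ∈ insert a (branch par j e)
    · rw [if_pos (mem_union_left _ c1)]
      rw [if_pos c1] at k3
      rw [if_neg (k7 c1)] at k4
      omega
    · rw [if_neg c1] at k3
      by_cases c2 : v ∈ insert b (branch par' j e')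
      · rw [if_pos (mem_union_right _ c2)]
        rw [if_pos c2] at k4
        omega
      · rw [if_neg c2] at k4
        omega
  · exact fun v => (Nat.sub_le _ _).trans (h.le v)
  · intro v hv
    rw [mem_union, not_or] at hv
    simp only [if_neg hv.2, h.eq v hv.1, Nat.sub_zero]

/-- Two vertices of positive demand are joined by a path of any long enough length that has the
right parity, and whose interior is unused. -/
theorem State.exists_path {Γ : SimpleGraph V} {μ q f κ j : ℕ} (hμ : 0 < μ) (hq : 2 ≤ q)
    (hroom : Roomy Γ μ q f) (σ : Γ.Coloring Bool) (hjoin : Joined Γ σ κ) (hκ : κ ≤ 2 ^ j)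
    (m : ℕ) {F : Finset V} {r : V → ℕ} (h : State Γ μ q F r) {a b : V} (hab : a ≠ b) (ha : a ∈ F)
    (hb : b ∈ F) (hra : 0 < r a) (hrb : 0 < r b) (hσ : σ a = σ b ↔ Odd m)
    (hF : #F + m + 2 * 2 ^ (j + 1) ≤ f) :
    ∃ w : ℕ → V, w 0 = a ∧ w (2 * j + 3 + m) = b ∧
      (∀ i < 2 * j + 3 + m, Γ.Adj (w i) (w (i + 1))) ∧
      (∀ i ≤ 2 * j + 3 + m, ∀ i' ≤ 2 * j + 3 + m, w i = w i' → i = i') ∧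
      (∀ i, 0 < i → i < 2 * j + 3 + m → w i ∉ F) ∧
      State Γ μ q (F ∪ (range (2 * j + 3 + m + 1)).image w)
        (fun v => r v - if v ∈ (range (2 * j + 3 + m + 1)).image w then 1 else 0) := by
  induction m generalizing F r a with
  | zero =>
    exact h.exists_path_aux hμ hq hroom σ hjoin hκ hab ha hb hra hrb (by simpa using hσ) hF
  | succ m ih =>
    -- One leaf at `a` lengthens the path by one and flips the parity; the path is then continued
    -- from the leaf.
    obtain ⟨y, hy, hay, hst⟩ := h.exists_leaf hμ hroom (by omega) ha hra
    have hyb : y ≠ b := fun e => hy (e ▸ hb)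
    have hya : y ≠ a := fun e => hy (e ▸ ha)
    have hσy := σ.valid hay
    obtain ⟨w, hw0, hwL, hwadj, hwinj, hwF, hwst⟩ := ih hst hyb (mem_insert_self y F)
      (mem_insert_of_mem hb)
      (by simp [hya, h.eq y hy]; omega) (by simp [hab.symm, hrb])
      (by
        have hbool : ∀ x y z : Bool, x ≠ y → (y = z ↔ ¬x = z) := by decide
        rw [hbool _ _ _ hσy, hσ, Nat.odd_add_one, not_not])
      (by rw [card_insert_of_notMem hy]; omega)
    have haw : ∀ i ≤ 2 * j + 3 + m, w i ≠ a := by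
      intro i hi hia
      rcases Nat.eq_zero_or_pos i with rfl | h0
      · exact hya (hw0.symm.trans hia)
      rcases hi.lt_or_eq with h1 | rfl
      · exact hwF i h0 h1 (mem_insert_of_mem (hia ▸ ha))
      · exact hab (hia.symm.trans hwL)
    let w' : ℕ → V := fun i => Nat.casesOn i a w
    have himage : (range (2 * j + 3 + (m + 1) + 1)).image w' =
        insert a ((range (2 * j + 3 + m + 1)).image w) := by
      ext v
      simp only [mem_image, mem_range, mem_insert]
      constructor
      · rintro ⟨i, hi, rfl⟩
        cases i with
        | zero => exact Or.inl rfl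
        | succ i => exact Or.inr ⟨i, by omega, rfl⟩
      · rintro (rfl | ⟨i, hi, rfl⟩)
        · exact ⟨0, by omega, rfl⟩
        · exact ⟨i + 1, by omega, rfl⟩
    refine ⟨w', rfl, hwL, ?_, ?_, ?_, ?_⟩
    · intro i hi
      cases i with
      | zero =>
        change Γ.Adj a (w 0)
        rwa [hw0]
      | succ i => exact hwadj i (by omega)
    · intro i hi i' hi' heq
      cases i with
      | zero =>
        cases i' with
        | zero => rfl
        | succ i' => exact absurd heq.symm (haw i' (by omega))
      | succ i =>
        cases i' with
        | zero => exact absurd heq (haw i (by omega))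
        | succ i' => rw [hwinj i (by omega) i' (by omega) heq]
    · intro i h0 hi
      cases i with
      | zero => omega
      | succ i =>
        change w i ∉ F
        rcases Nat.eq_zero_or_pos i with rfl | h1
        · rwa [hw0]
        · exact fun h => hwF i h1 (by omega) (mem_insert_of_mem h)
    · rw [himage]
      convert hwst using 1
      · ext v
        have : v = y → v ∈ (range (2 * j + 3 + m + 1)).image w := fun e =>
          mem_image.2 ⟨0, by simp, hw0.trans e.symm⟩
        have : v = a → v ∈ F := fun e => e ▸ ha
        simp only [mem_union, mem_insert]
        tauto
      · ext v
        by_cases hva : v = a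
        · subst hva
          have : v ∉ (range (2 * j + 3 + m + 1)).image w := by
            rw [mem_image]
            rintro ⟨i, hi, hiv⟩
            exact haw i (by rw [mem_range] at hi; omega) hiv
          rw [if_pos (mem_insert_self _ _), if_neg this]
          simp
        · simp only [mem_insert, hva, false_or, Pi.sub_apply]
          simp [hva]

end Connecting

/-! ### Embedding `H` along its construction -/

section Embedding

open Finset
open scoped Classical

variable {V W : Type*} [Fintype V] [Fintype W]

/-- The number of edges of `H` at `x` that are missing from the subgraph `S`. -/
noncomputable def missing {H : SimpleGraph W} (S : H.Subgraph) (x : W) : ℕ :=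
  #{y | H.Adj x y ∧ ¬S.Adj x y}

theorem missing_mono {H : SimpleGraph W} {S S' : H.Subgraph} (h : S ≤ S') (x : W) :
    missing S' x ≤ missing S x := by
  refine card_le_card fun y hy => ?_
  simp only [mem_filter, mem_univ, true_and] at hy ⊢
  exact ⟨hy.1, fun hS => hy.2 (h.2 hS)⟩

theorem missing_lt {H : SimpleGraph W} {S S' : H.Subgraph} (h : S ≤ S') {x y : W}
    (hy' : S'.Adj x y) (hy : ¬S.Adj x y) : missing S' x < missing S x := by
  refine card_lt_card (Finset.ssubset_iff_subset_ne.2 ⟨fun z hz => ?_, fun heq => ?_⟩)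
  · simp only [mem_filter, mem_univ, true_and] at hz ⊢
    exact ⟨hz.1, fun hS => hz.2 (h.2 hS)⟩
  · have h1 : y ∈ univ.filter fun z => H.Adj x z ∧ ¬S.Adj x z := by
      simpa using ⟨hy'.adj_sub, hy⟩
    rw [← heq] at h1
    simp only [mem_filter, mem_univ, true_and] at h1
    exact h1.2 hy'

theorem missing_le {H : SimpleGraph W} {d : ℕ} (hd : ∀ x, (H.neighborSet x).ncard ≤ d)
    (S : H.Subgraph) (x : W) : missing S x ≤ d := by
  refine le_trans ?_ (hd x)
  rw [missing, ← Set.ncard_coe_finset]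
  refine Set.ncard_le_ncard (fun y hy => ?_) (Set.toFinite _)
  simp only [coe_filter, mem_univ, true_and] at hy
  exact hy.1

theorem bool_eq_of_ne {a b b' : Bool} (h : a ≠ b) (h' : a ≠ b') : b = b' := by
  revert a b b'
  decide

/-- `f` embeds the subgraph `S` of `H` into `Γ`, respecting the colourings, in such a way that the
state of used vertices and demands leaves room for the missing edges. -/
structure PartialCopy {H : SimpleGraph W} {Γ : SimpleGraph V} (σ : V → Bool) (c : W → Bool)
    (μ q : ℕ) (Z : Finset V) (S : H.Subgraph) (f : W → V) (F : Finset V) (r : V → ℕ) : Prop where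
  state : State Γ μ q F r
  subset : ∀ v ∈ F, v ∈ Z ∨ ∃ x ∈ S.verts, f x = v
  mem : ∀ x ∈ S.verts, f x ∈ F
  inj : ∀ x ∈ S.verts, ∀ y ∈ S.verts, f x = f y → x = y
  adj : ∀ x y, S.Adj x y → Γ.Adj (f x) (f y)
  color : ∀ x ∈ S.verts, σ (f x) = c x
  demand : ∀ x ∈ S.verts, missing S x ≤ r (f x)

theorem PartialCopy.card_le {H : SimpleGraph W} {Γ : SimpleGraph V} {σ : V → Bool}
    {c : W → Bool} {μ q : ℕ} {Z : Finset V} {S : H.Subgraph} {f : W → V} {F : Finset V}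
    {r : V → ℕ} (h : PartialCopy (Γ := Γ) σ c μ q Z S f F r) : #F ≤ #Z + Fintype.card W := by
  have hsub : F ⊆ Z ∪ univ.image f := by
    intro v hv
    rcases h.subset v hv with hv | ⟨x, -, rfl⟩
    · exact mem_union_left _ hv
    · exact mem_union_right _ (mem_image_of_mem f (mem_univ x))
  refine (card_le_card hsub).trans ((card_union_le _ _).trans ?_)
  gcongr
  exact card_image_le

/-- The image of `x` spends one unit of demand while `x` loses a missing edge; the new image was
unused, so its demand is `q ≥ d`. -/
theorem PartialCopy.exists_addLeaf {H : SimpleGraph W} {Γ : SimpleGraph V} {μ q n d : ℕ}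
    (hμ : 0 < μ) (hdq : d ≤ q) (hd : ∀ x, (H.neighborSet x).ncard ≤ d)
    (hroom : Roomy Γ μ q n) (σ : Γ.Coloring Bool) (c : H.Coloring Bool) {Z : Finset V}
    (hn : #Z + Fintype.card W ≤ n) {S : H.Subgraph} {f : W → V} {F : Finset V}
    {r : V → ℕ} (h : PartialCopy (Γ := Γ) σ c μ q Z S f F r) {x y : W} (hx : x ∈ S.verts)
    (hy : y ∉ S.verts) (hxy : H.Adj x y) :
    ∃ f F r, PartialCopy (Γ := Γ) σ c μ q Z (S ⊔ H.subgraphOfAdj hxy) f F r := by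
  have hnadj : ¬S.Adj x y := fun hS => hy hS.snd_mem
  have hadj' : (S ⊔ H.subgraphOfAdj hxy).Adj x y := Or.inr rfl
  have hle : S ≤ S ⊔ H.subgraphOfAdj hxy := le_sup_left
  have hlt := missing_lt hle hadj' hnadj
  obtain ⟨v, hv, hxv, hst⟩ := h.state.exists_leaf hμ hroom (h.card_le.trans hn) (h.mem x hx)
    ((Nat.zero_le _).trans_lt (hlt.trans_le (h.demand x hx)))
  have hvx : v ≠ f x := fun e => hv (e ▸ h.mem x hx)
  have hold : ∀ z ∈ S.verts, Function.update f y v z = f z := fun z hz =>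
    Function.update_of_ne (fun e : z = y => hy (e ▸ hz)) _ _
  have hnew : Function.update f y v y = v := Function.update_self _ _ _
  have hverts : ∀ z ∈ (S ⊔ H.subgraphOfAdj hxy).verts, z ∈ S.verts ∨ z = y := by
    intro z hz
    simp only [SimpleGraph.Subgraph.verts_sup, SimpleGraph.subgraphOfAdj_verts, Set.mem_union,
      Set.mem_insert_iff, Set.mem_singleton_iff] at hz
    rcases hz with hz | rfl | hz
    · exact Or.inl hz
    · exact Or.inl hx
    · exact Or.inr hz
  refine ⟨Function.update f y v, insert v F, _, hst, ?_, ?_, ?_, ?_, ?_, ?_⟩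
  · intro u hu
    rcases mem_insert.1 hu with rfl | hu
    · exact Or.inr ⟨y, hadj'.snd_mem, hnew⟩
    · rcases h.subset u hu with hu | ⟨z, hz, rfl⟩
      · exact Or.inl hu
      · exact Or.inr ⟨z, hle.1 hz, hold z hz⟩
  · intro z hz
    rcases hverts z hz with hz | rfl
    · rw [hold z hz]
      exact mem_insert_of_mem (h.mem z hz)
    · rw [hnew]
      exact mem_insert_self _ _
  · intro z hz z' hz' heq
    rcases hverts z hz with h1 | rfl <;> rcases hverts z' hz' with h2 | rfl
    · rw [hold z h1, hold z' h2] at heq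
      exact h.inj z h1 z' h2 heq
    · rw [hold z h1, hnew] at heq
      exact absurd (heq ▸ h.mem z h1) hv
    · rw [hold z' h2, hnew] at heq
      exact absurd (heq ▸ h.mem z' h2) hv
    · rfl
  · intro z z' hzz'
    rcases hzz' with hzz' | hzz'
    · rw [hold z hzz'.fst_mem, hold z' hzz'.snd_mem]
      exact h.adj z z' hzz'
    · rw [SimpleGraph.subgraphOfAdj_adj, Sym2.eq_iff] at hzz'
      rcases hzz' with ⟨rfl, rfl⟩ | ⟨rfl, rfl⟩
      · rwa [hold _ hx, hnew]
      · rw [hold _ hx, hnew]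
        exact hxv.symm
  · intro z hz
    rcases hverts z hz with hz | rfl
    · rw [hold z hz]
      exact h.color z hz
    · have h1 := σ.valid hxv
      have h2 := c.valid hxy
      rw [h.color x hx] at h1
      rw [hnew]
      exact bool_eq_of_ne h1 h2
  · intro z hz
    rcases hverts z hz with hz | rfl
    · rw [hold z hz]
      have h1 := missing_mono hle z
      have h2 := h.demand z hz
      by_cases hzx : z = x
      · subst hzx
        simp only [Pi.sub_apply, Pi.single_eq_same]
        omega
      · have hne : f z ≠ f x := fun e => hzx (h.inj z hz x hx e)
        simp only [Pi.sub_apply, Pi.single_eq_of_ne hne]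
        omega
    · rw [hnew, Pi.sub_apply, Pi.single_eq_of_ne hvx, h.state.eq v hv]
      exact (missing_le hd _ _).trans hdq

theorem PartialCopy.exists_addPath {H : SimpleGraph W} {Γ : SimpleGraph V} {μ q n d κ j : ℕ}
    (hμ : 0 < μ) (hq : 2 ≤ q) (hdq : d < q) (hd : ∀ x, (H.neighborSet x).ncard ≤ d)
    (hroom : Roomy Γ μ q n) (σ : Γ.Coloring Bool) (hjoin : Joined Γ σ κ) (hκ : κ ≤ 2 ^ j)
    (c : H.Coloring Bool) {Z : Finset V}
    (hn : #Z + 2 * Fintype.card W + 2 * 2 ^ (j + 1) ≤ n) {S : H.Subgraph} {f : W → V}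
    {F : Finset V} {r : V → ℕ} (h : PartialCopy (Γ := Γ) σ c μ q Z S f F r) {x y : W}
    (hx : x ∈ S.verts) (hy : y ∈ S.verts) (hne : x ≠ y) (p : H.Walk x y) (hp : p.IsPath)
    (hlen : 2 * j + 3 ≤ p.length)
    (hint : ∀ z ∈ p.support, z ≠ x → z ≠ y → z ∉ S.verts) :
    ∃ f F r, PartialCopy (Γ := Γ) σ c μ q Z (S ⊔ p.toSubgraph) f F r := by
  obtain ⟨m, hm⟩ := Nat.exists_eq_add_of_le hlen
  have hinj : ∀ i ≤ p.length, ∀ i' ≤ p.length, p.getVert i = p.getVert i' → i = i' :=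
    fun i hi i' hi' he => hp.getVert_injOn hi hi' he
  have hint' : ∀ i, 0 < i → i < p.length → p.getVert i ∉ S.verts := by
    intro i h0 hi
    refine hint _ (p.getVert_mem_support i) (fun e => ?_) (fun e => ?_)
    · have := hinj i hi.le 0 (by omega) (by rw [e, p.getVert_zero])
      omega
    · have := hinj i hi.le p.length le_rfl (by rw [e, p.getVert_length])
      omega
  have hle : S ≤ S ⊔ p.toSubgraph := le_sup_left
  have hpadj : ∀ i < p.length, (S ⊔ p.toSubgraph).Adj (p.getVert i) (p.getVert (i + 1)) :=
    fun i hi => Or.inr (p.toSubgraph_adj_getVert hi)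
  have hltx : missing (S ⊔ p.toSubgraph) x < missing S x := by
    have h1 := hpadj 0 (by omega)
    rw [p.getVert_zero] at h1
    exact missing_lt hle h1 fun hS => hint' 1 one_pos (by omega) hS.snd_mem
  have hlty : missing (S ⊔ p.toSubgraph) y < missing S y := by
    have h1 := hpadj (p.length - 1) (by omega)
    rw [Nat.sub_add_cancel (by omega), p.getVert_length] at h1
    exact missing_lt hle h1.symm fun hS => hint' (p.length - 1) (by omega) (by omega) hS.snd_mem
  have hrx := h.demand x hx
  have hry := h.demand y hy
  obtain ⟨w, hw0, hwL, hwadj, hwinj, hwF, hwst⟩ := h.state.exists_path hμ hq hroom σ hjoin hκ m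
    (fun e => hne (h.inj x hx y hy e)) (h.mem x hx) (h.mem y hy) (by omega) (by omega)
    -- The path has length `2 * j + 3 + m`, so its ends have equal colours exactly when `m` is odd.
    (by
      have h1 := c.even_length_iff_congr p
      rw [h.color x hx, h.color y hy, Bool.eq_iff_iff, ← h1, hm, Nat.even_add]
      have : ¬Even (2 * j + 3) := by
        rw [Nat.not_even_iff_odd]
        exact ⟨j + 1, by ring⟩
      simp [this])
    (by
      have h1 := h.card_le
      have h2 := hp.length_lt
      omega)
  rw [← hm] at hwL hwadj hwinj hwF hwst
  let g : W → V := fun z =>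
    if z ∈ S.verts then f z else if hz : ∃ i ≤ p.length, p.getVert i = z then w hz.choose else f z
  have hold : ∀ z ∈ S.verts, g z = f z := fun z hz => if_pos hz
  have hpath : ∀ i ≤ p.length, g (p.getVert i) = w i := by
    intro i hi
    rcases Nat.eq_zero_or_pos i with rfl | h0
    · rw [p.getVert_zero, hold x hx, hw0]
    rcases hi.lt_or_eq with h1 | rfl
    · have hex : ∃ i' ≤ p.length, p.getVert i' = p.getVert i := ⟨i, hi, rfl⟩
      have h2 : g (p.getVert i) = w hex.choose := by
        simp only [g, if_neg (hint' i h0 h1), dif_pos hex]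
      rw [h2, hinj _ hex.choose_spec.1 i hi hex.choose_spec.2]
    · rw [p.getVert_length, hold y hy, hwL]
  have hverts : ∀ z ∈ (S ⊔ p.toSubgraph).verts,
      z ∈ S.verts ∨ ∃ i, 0 < i ∧ i < p.length ∧ z = p.getVert i := by
    intro z hz
    rcases hz with hz | hz
    · exact Or.inl hz
    · rw [SimpleGraph.Walk.mem_verts_toSubgraph, SimpleGraph.Walk.mem_support_iff_exists_getVert]
        at hz
      obtain ⟨i, rfl, hi⟩ := hz
      rcases Nat.eq_zero_or_pos i with rfl | h0
      · rw [p.getVert_zero]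
        exact Or.inl hx
      rcases hi.lt_or_eq with h1 | rfl
      · exact Or.inr ⟨i, h0, h1, rfl⟩
      · rw [p.getVert_length]
        exact Or.inl hy
  have hcol : ∀ i ≤ p.length, σ (w i) = c (p.getVert i) := by
    intro i
    induction i with
    | zero => rw [hw0, p.getVert_zero]; exact fun _ => h.color x hx
    | succ i ih =>
      intro hi
      have h1 := σ.valid (hwadj i (by omega))
      have h2 := c.valid (p.adj_getVert_succ (i := i) (by omega))
      rw [ih (by omega)] at h1
      exact bool_eq_of_ne h1 h2
  have hmemw : ∀ i ≤ p.length, w i ∈ (range (p.length + 1)).image w := fun i hi =>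
    mem_image_of_mem w (mem_range.2 (by omega))
  refine ⟨g, _, _, hwst, ?_, ?_, ?_, ?_, ?_, ?_⟩
  · intro u hu
    rcases mem_union.1 hu with hu | hu
    · rcases h.subset u hu with hu | ⟨z, hz, rfl⟩
      · exact Or.inl hu
      · exact Or.inr ⟨z, hle.1 hz, hold z hz⟩
    · obtain ⟨i, hi, rfl⟩ := mem_image.1 hu
      have hi : i ≤ p.length := by rw [mem_range] at hi; omega
      refine Or.inr ⟨p.getVert i, Or.inr ?_, hpath i hi⟩
      rw [SimpleGraph.Walk.mem_verts_toSubgraph]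
      exact p.getVert_mem_support i
  · intro z hz
    rcases hverts z hz with hz | ⟨i, -, hi, rfl⟩
    · rw [hold z hz]
      exact mem_union_left _ (h.mem z hz)
    · rw [hpath i hi.le]
      exact mem_union_right _ (hmemw i hi.le)
  · intro z hz z' hz' heq
    rcases hverts z hz with hz | ⟨i, h0, hi, rfl⟩ <;>
      rcases hverts z' hz' with hz' | ⟨i', h0', hi', rfl⟩
    · rw [hold z hz, hold z' hz'] at heq
      exact h.inj z hz z' hz' heq
    · rw [hold z hz, hpath i' hi'.le] at heq
      exact absurd (heq ▸ h.mem z hz) (hwF i' h0' hi')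
    · rw [hold z' hz', hpath i hi.le] at heq
      exact absurd (heq ▸ h.mem z' hz') (hwF i h0 hi)
    · rw [hpath i hi.le, hpath i' hi'.le] at heq
      rw [hwinj i hi.le i' hi'.le heq]
  · intro z z' hzz'
    rcases hzz' with hzz' | hzz'
    · rw [hold z hzz'.fst_mem, hold z' hzz'.snd_mem]
      exact h.adj z z' hzz'
    · obtain ⟨i, he, hi⟩ := (p.toSubgraph_adj_iff).1 hzz'
      have h1 := hwadj i hi
      rw [← hpath i hi.le, ← hpath (i + 1) hi] at h1
      rcases Sym2.eq_iff.1 he with ⟨rfl, rfl⟩ | ⟨rfl, rfl⟩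
      · exact h1
      · exact h1.symm
  · intro z hz
    rcases hverts z hz with hz | ⟨i, -, hi, rfl⟩
    · rw [hold z hz]
      exact h.color z hz
    · rw [hpath i hi.le]
      exact hcol i hi.le
  · intro z hz
    rcases hverts z hz with hz | ⟨i, h0, hi, rfl⟩
    · rw [hold z hz]
      have h1 := missing_mono hle z
      have h2 := h.demand z hz
      by_cases hzw : f z ∈ (range (p.length + 1)).image w
      · rw [if_pos hzw]
        obtain ⟨i, hi, hiz⟩ := mem_image.1 hzw
        have hi : i ≤ p.length := by rw [mem_range] at hi; omega
        rcases Nat.eq_zero_or_pos i with rfl | h0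
        · rw [h.inj z hz x hx (by rw [← hiz, hw0])]
          omega
        rcases hi.lt_or_eq with h3 | rfl
        · exact absurd (hiz ▸ h.mem z hz) (hwF i h0 h3)
        · rw [h.inj z hz y hy (by rw [← hiz, hwL])]
          omega
      · rw [if_neg hzw]
        omega
    -- An interior vertex keeps demand `q - 1`, which is where `d < q` rather than `d ≤ q` is
    -- needed.
    · rw [hpath i hi.le, if_pos (hmemw i hi.le), h.state.eq _ (hwF i h0 hi)]
      have := missing_le hd (S ⊔ p.toSubgraph) (p.getVert i)
      omega

/-- A bipartite graph built from leaves and long paths is contained in every roomy joined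
bipartite graph. -/
theorem isContained_of_built {H : SimpleGraph W} {Γ : SimpleGraph V} {μ q n d κ j : ℕ} {ℓ : ℝ}
    (hμ : 0 < μ) (hq : 2 ≤ q) (hdq : d < q) (hd : ∀ x, (H.neighborSet x).ncard ≤ d)
    (hroom : Roomy Γ μ q n) (σ : Γ.Coloring Bool) (hjoin : Joined Γ σ κ) (hκ : κ ≤ 2 ^ j)
    (hσ : ∀ b, μ ≤ #{v | σ v = b}) (hn : 3 * μ + 2 * Fintype.card W + 2 * 2 ^ (j + 1) ≤ n)
    (c : H.Coloring Bool) (hℓ : (2 * j + 3 : ℕ) ≤ ℓ) (hH : Built ℓ (⊤ : H.Subgraph)) :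
    H.IsContained Γ := by
  obtain ⟨Z, hZ, hinit⟩ := hroom.exists_initial (by omega)
  have key : ∀ S : H.Subgraph, Built ℓ S → ∃ f F r, PartialCopy (Γ := Γ) σ c μ q Z S f F r := by
    intro S hS
    induction hS with
    | single x =>
      obtain ⟨v, hv, hvZ⟩ := exists_mem_notMem_of_card_lt_card (hZ.trans_le (hσ (c x)))
      simp only [mem_filter, mem_univ, true_and] at hv
      refine ⟨fun _ => v, insert v Z, fun u => if u ∈ Z then 0 else q,
        ⟨hinit v, ?_, ?_⟩, ?_, ?_, ?_, ?_, ?_, ?_⟩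
      · intro u
        split_ifs <;> omega
      · intro u hu
        rw [if_neg fun h => hu (mem_insert_of_mem h)]
      · intro u hu
        rcases mem_insert.1 hu with rfl | hu
        · exact Or.inr ⟨x, rfl, rfl⟩
        · exact Or.inl hu
      · exact fun _ _ => mem_insert_self _ _
      · rintro y rfl z rfl -
        rfl
      · rintro y z hyz
        exact absurd hyz (by simp)
      · rintro y rfl
        exact hv
      · intro y _
        rw [if_neg hvZ]
        exact (missing_le hd _ _).trans hdq.le
    | addLeaf S x y hS hx hy hxy ih =>
      obtain ⟨f, F, r, h⟩ := ih
      exact h.exists_addLeaf hμ hdq.le hd hroom σ c (by omega) hx hy hxy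
    | addPath S x y hS hx hy hne p hp hlen hint ih =>
      obtain ⟨f, F, r, h⟩ := ih
      exact h.exists_addPath hμ hq hdq hd hroom σ hjoin hκ c (by omega) hx hy hne p hp
        (by exact_mod_cast hℓ.trans hlen) hint
  obtain ⟨f, F, r, h⟩ := key ⊤ hH
  exact ⟨⟨⟨f, fun {x y} hxy => h.adj x y hxy⟩, fun x y hxy => h.inj x trivial y trivial hxy⟩⟩

end Embedding

/-! ### Removing the non-grey colours between large sets -/

section Sparsify

open Finset
open scoped Classical

variable {V W : Type*} [Fintype V] [Fintype W]

/-- A set of `2 * κ` vertices has `κ` of one colour, and these miss fewer than `κ` vertices of the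
other colour. The term `4 * q * κ` covers `q * #X` for `#X ≤ 4 * κ`. -/
theorem Joined.roomy {Γ : SimpleGraph V} {σ : V → Bool} {κ q f : ℕ} (h : Joined Γ σ κ)
    (hσ : ∀ b, f + (4 * q + 1) * κ ≤ #{v | σ v = b}) : Roomy Γ (2 * κ) q f := by
  intro X h1 h2
  obtain ⟨b, hb⟩ : ∃ b, κ ≤ #{x ∈ X | σ x = b} := by
    by_contra! hcon
    have h3 := card_filter_add_card_filter_not (s := X) (fun x => σ x = true)
    have h4 := hcon true
    have h5 := hcon false
    simp only [Bool.not_eq_true] at h3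
    omega
  have hfew : #(({v | σ v = !b} : Finset V) \ nbr Γ X) < κ := by
    by_contra! hcon
    obtain ⟨x, hx, y, hy, hxy⟩ := h.exists_adj (X := {x ∈ X | σ x = b})
      (fun x hx => (mem_filter.1 hx).2)
      (fun y hy => (mem_filter.1 (mem_sdiff.1 hy).1).2) hb hcon
    exact (mem_sdiff.1 hy).2 (mem_nbr.2 ⟨x, (mem_filter.1 hx).1, hxy⟩)
  have h3 := le_card_sdiff (nbr Γ X) ({v | σ v = !b} : Finset V)
  have h4 := hσ !b
  have h5 : q * #X ≤ 4 * q * κ := by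
    calc q * #X ≤ q * (2 * (2 * κ)) := Nat.mul_le_mul_left q h2
      _ = 4 * q * κ := by ring
  rw [add_mul, one_mul] at h4
  omega

/-- Either `Φ` contains `H`, or there are large subsets of `A` and `B` without edges of `Φ`
between them. -/
theorem isContained_or_exists_no_adj {H : SimpleGraph W} (Φ : SimpleGraph V) {d κ : ℕ} {ℓ : ℝ}
    (hd : ∀ x, (H.neighborSet x).ncard ≤ d) (c : H.Coloring Bool) (hH : Built ℓ (⊤ : H.Subgraph))
    (hℓ : ∀ j : ℕ, 2 ^ (j + 2) ≤ Fintype.card V → (2 * j + 3 : ℕ) ≤ ℓ) (hκ : 0 < κ)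
    (hW : Fintype.card W ≤ κ) {A B : Finset V} (hAB : Disjoint A B)
    (hA : κ * (4 * d + 25) ≤ #A) (hB : κ * (4 * d + 25) ≤ #B) :
    H.IsContained Φ ∨ ∃ A' ⊆ A, ∃ B' ⊆ B, κ ≤ #A' ∧ κ ≤ #B' ∧
      ∀ a ∈ A', ∀ b ∈ B', ¬Φ.Adj a b := by
  by_cases hex : ∃ A' ⊆ A, ∃ B' ⊆ B, κ ≤ #A' ∧ κ ≤ #B' ∧ ∀ a ∈ A', ∀ b ∈ B', ¬Φ.Adj a b
  · exact Or.inr hex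
  left
  push Not at hex
  let σ' : {v // v ∈ A ∪ B} → Bool := fun v => decide (v.1 ∈ A)
  let Γ : SimpleGraph {v // v ∈ A ∪ B} :=
    { Adj := fun u v => Φ.Adj u v ∧ σ' u ≠ σ' v
      symm := ⟨fun u v h => ⟨h.1.symm, h.2.symm⟩⟩
      loopless := ⟨fun u h => h.2 rfl⟩ }
  let σ : Γ.Coloring Bool := SimpleGraph.Coloring.mk σ' fun {u v} h => h.2
  have hσt : ∀ v, σ v = true → v.1 ∈ A := fun v hv => of_decide_eq_true hv
  have hσf : ∀ v, σ v = false → v.1 ∈ B := fun v hv =>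
    (mem_union.1 v.2).resolve_left (of_decide_eq_false hv)
  have hjoin : Joined Γ σ κ := by
    intro X Y hX hY hκX hκY
    obtain ⟨a, ha, b, hb, hab⟩ := hex (X.map (Function.Embedding.subtype _))
      (fun a ha => by
        obtain ⟨x, hx, rfl⟩ := mem_map.1 ha
        exact hσt x (hX x hx))
      (Y.map (Function.Embedding.subtype _))
      (fun a ha => by
        obtain ⟨y, hy, rfl⟩ := mem_map.1 ha
        exact hσf y (hY y hy))
      (by rwa [card_map]) (by rwa [card_map])
    obtain ⟨x, hx, rfl⟩ := mem_map.1 ha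
    obtain ⟨y, hy, rfl⟩ := mem_map.1 hb
    refine ⟨x, hx, y, hy, hab, ?_⟩
    change σ x ≠ σ y
    rw [hX x hx, hY y hy]
    decide
  have hcard : ∀ b, κ * (4 * d + 25) ≤ #{v | σ v = b} := by
    intro b
    cases b with
    | true =>
      refine hA.trans (card_le_card_of_surjOn Subtype.val fun a ha => ?_)
      refine ⟨⟨a, mem_union_left _ ha⟩, ?_, rfl⟩
      simp only [coe_filter, mem_univ, true_and]
      exact decide_eq_true ha
    | false =>
      refine hB.trans (card_le_card_of_surjOn Subtype.val fun b hb => ?_)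
      refine ⟨⟨b, mem_union_right _ hb⟩, ?_, rfl⟩
      simp only [coe_filter, mem_univ, true_and]
      exact decide_eq_false (disjoint_right.1 hAB hb)
  -- The trees get parameter `j = Nat.log 2 κ + 1`, so that `κ ≤ 2 ^ j ≤ 2 * κ`.
  have hj1 : κ ≤ 2 ^ (Nat.log 2 κ + 1) := (Nat.lt_pow_succ_log_self one_lt_two κ).le
  have hj2 := Nat.pow_log_le_self 2 hκ.ne'
  have hpow1 : 2 ^ (Nat.log 2 κ + 1) = 2 * 2 ^ Nat.log 2 κ := by ring
  have hpow2 : 2 ^ (Nat.log 2 κ + 1 + 1) = 4 * 2 ^ Nat.log 2 κ := by ring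
  have hpow3 : 2 ^ (Nat.log 2 κ + 1 + 2) = 8 * 2 ^ Nat.log 2 κ := by ring
  have hmul : κ * (4 * d + 25) = 4 * (κ * d) + 25 * κ := by ring
  -- The budget `16 * κ` is `6 * κ` for `3 * μ`, `2 * κ` for `H` and `8 * κ` for the two trees. With
  -- `q = d + 2` this gives `16 + 4 * q + 1 = 4 * d + 25`.
  have hroom : Roomy Γ (2 * κ) (d + 2) (16 * κ) := hjoin.roomy fun b => by
    refine le_trans (le_of_eq ?_) (hcard b)
    ring
  have hcon : H.IsContained Γ := isContained_of_built (d := d) (ℓ := ℓ) (by omega) (by omega)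
    (by omega) hd hroom σ hjoin hj1
    (fun b => le_trans (by omega) (hcard b)) (by omega) c
    (hℓ (Nat.log 2 κ + 1) (by
      have := card_le_univ A
      omega)) hH
  obtain ⟨f⟩ := hcon
  exact ⟨⟨⟨fun x => (f x).1, fun {x y} hxy => (f.toHom.map_adj hxy).1⟩,
    fun x y hxy => f.injective (Subtype.val_injective hxy)⟩⟩

/-- Passing to subsets of a family of disjoint sets until no edges of the given graphs are left
between different sets. -/
theorem isContained_or_exists_family {ι τ : Type*} {H : SimpleGraph W} (Φ : ι → SimpleGraph V)
    {d κ : ℕ} {ℓ : ℝ} (hd : ∀ x, (H.neighborSet x).ncard ≤ d) (c : H.Coloring Bool)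
    (hH : Built ℓ (⊤ : H.Subgraph))
    (hℓ : ∀ j : ℕ, 2 ^ (j + 2) ≤ Fintype.card V → (2 * j + 3 : ℕ) ≤ ℓ) (hκ : 0 < κ)
    (hW : Fintype.card W ≤ κ) (J : Finset (τ × τ × ι)) (A : τ → Finset V)
    (hA : Pairwise fun a b => Disjoint (A a) (A b)) (hcard : ∀ a, κ * (4 * d + 25) ^ #J ≤ #(A a)) :
    (∃ i, H.IsContained (Φ i)) ∨ ∃ A' : τ → Finset V, (∀ a, A' a ⊆ A a) ∧ (∀ a, κ ≤ #(A' a)) ∧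
      ∀ a b i, (a, b, i) ∈ J → a ≠ b → ∀ x ∈ A' a, ∀ y ∈ A' b, ¬(Φ i).Adj x y := by
  induction J using Finset.induction generalizing A with
  | empty => exact Or.inr ⟨A, fun _ => subset_rfl, by simpa using hcard, by simp⟩
  | insert p J hp ih =>
    obtain ⟨a, b, i⟩ := p
    rw [card_insert_of_notMem hp, pow_succ, ← mul_assoc] at hcard
    have hpos : 0 < (4 * d + 25) ^ #J := by positivity
    have hcard' : ∀ e, κ * (4 * d + 25) ^ #J ≤ #(A e) := fun e =>
      (Nat.le_mul_of_pos_right _ (by omega)).trans (hcard e)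
    by_cases hab : a = b
    · subst hab
      rcases ih A hA hcard' with h | ⟨A', h1, h2, h3⟩
      · exact Or.inl h
      · refine Or.inr ⟨A', h1, h2, fun a' b' i' hmem hne => ?_⟩
        rcases mem_insert.1 hmem with heq | hmem
        · simp only [Prod.mk.injEq] at heq
          exact absurd (heq.1.trans heq.2.1.symm) hne
        · exact h3 a' b' i' hmem hne
    · rcases isContained_or_exists_no_adj (Φ i) hd c hH hℓ (Nat.mul_pos hκ hpos)
        (hW.trans (Nat.le_mul_of_pos_right _ hpos)) (hA hab) (hcard a) (hcard b) with
        h | ⟨X, hX, Y, hY, hκX, hκY, hXY⟩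
      · exact Or.inl ⟨i, h⟩
      · let A₁ : τ → Finset V := fun e => if e = a then X else if e = b then Y else A e
        have hA₁a : A₁ a = X := if_pos rfl
        have hA₁b : A₁ b = Y := by simp [A₁, Ne.symm hab]
        have hsub : ∀ e, A₁ e ⊆ A e := by
          intro e
          by_cases h1 : e = a
          · rw [h1, hA₁a]
            exact hX
          · by_cases h2 : e = b
            · rw [h2, hA₁b]
              exact hY
            · simp [A₁, h1, h2]
        have hcard₁ : ∀ e, κ * (4 * d + 25) ^ #J ≤ #(A₁ e) := by
          intro e
          by_cases h1 : e = a
          · rw [h1, hA₁a]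
            exact hκX
          · by_cases h2 : e = b
            · rw [h2, hA₁b]
              exact hκY
            · simpa [A₁, h1, h2] using hcard' e
        rcases ih A₁ (fun e e' hne => disjoint_of_subset_left (hsub e)
          (disjoint_of_subset_right (hsub e') (hA hne))) hcard₁ with h | ⟨A', h1, h2, h3⟩
        · exact Or.inl h
        · refine Or.inr ⟨A', fun e => (h1 e).trans (hsub e), h2, fun a' b' i' hmem hne => ?_⟩
          rcases mem_insert.1 hmem with heq | hmem
          · simp only [Prod.mk.injEq] at heq
            obtain ⟨rfl, rfl, rfl⟩ := heq
            intro x hx y hy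
            exact hXY x (hA₁a ▸ h1 _ hx) y (hA₁b ▸ h1 _ hy)
          · exact h3 a' b' i' hmem hne

end Sparsify

/-! ### Growing balls in the expander -/

section Balls

open Finset
open scoped Classical

variable {V : Type*} [Fintype V]

/-- The set of vertices reached from `A` in at most `i` steps outside `Z`. -/
noncomputable def ball (G : SimpleGraph V) (Z A : Finset V) : ℕ → Finset V
  | 0 => A
  | i + 1 => ball G Z A i ∪ (nbr G (ball G Z A i) \ Z)

theorem exists_edist_le_of_mem_ball {G : SimpleGraph V} {Z A : Finset V} {i : ℕ} {v : V}
    (hv : v ∈ ball G Z A i) : ∃ u ∈ A, G.edist u v ≤ i := by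
  induction i generalizing v with
  | zero => exact ⟨v, hv, by simp⟩
  | succ i ih =>
    rcases mem_union.1 hv with hv | hv
    · obtain ⟨u, hu, huv⟩ := ih hv
      exact ⟨u, hu, huv.trans (by exact_mod_cast Nat.le_succ i)⟩
    · obtain ⟨w, hw, hwv⟩ := mem_nbr.1 (mem_sdiff.1 hv).1
      obtain ⟨u, hu, huw⟩ := ih hw
      refine ⟨u, hu, (SimpleGraph.edist_triangle (v := w)).trans ?_⟩
      rw [SimpleGraph.edist_eq_one_iff_adj.2 hwv]
      push_cast
      gcongr

theorem disjoint_ball {G : SimpleGraph V} {Z A : Finset V} (h : Disjoint A Z) (i : ℕ) :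
    Disjoint (ball G Z A i) Z := by
  induction i with
  | zero => exact h
  | succ i ih => exact disjoint_union_left.2 ⟨ih, disjoint_sdiff_self_left⟩

/-- Any two disjoint sets of at least `g` vertices are joined by an edge. -/
def EdgeBetween (G : SimpleGraph V) (g : ℕ) : Prop :=
  ∀ A B : Finset V, Disjoint A B → g ≤ #A → g ≤ #B → ∃ a ∈ A, ∃ b ∈ B, G.Adj a b

/-- A set `X` with `g ≤ #X ≤ 2 * g` has fewer than `g` vertices outside itself and its
neighbourhood, so it expands by more than its size once `5 * g` is below the number of vertices.
`ExpanderRamsey.exists_core` passes this on to small sets. -/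
theorem EdgeBetween.exists_core {G : SimpleGraph V} {g : ℕ} (h : EdgeBetween G g)
    (hV : 5 * g < Fintype.card V) :
    ∃ Z : Finset V, #Z < g ∧ ∀ X : Finset V, Disjoint X Z → X.Nonempty → #X ≤ g →
      #X < #(nbr G X \ (Z ∪ X)) := by
  have := ExpanderRamsey.exists_core G (μ := g) (q := 1) fun X h1 h2 => by
    have hfew : #(univ \ (X ∪ (nbr G X \ X))) < g := by
      by_contra! hcon
      obtain ⟨a, ha, b, hb, hab⟩ := h X _
        (disjoint_of_subset_left subset_union_left disjoint_sdiff) h1 hcon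
      simp only [mem_sdiff, mem_univ, true_and, mem_union, not_or, not_and, not_not] at hb
      exact hb.1 (hb.2 (mem_nbr.2 ⟨a, ha, hab⟩))
    have h3 := le_card_sdiff (X ∪ (nbr G X \ X)) univ
    have h4 := card_union_le X (nbr G X \ X)
    rw [card_univ] at h3
    omega
  simpa only [one_mul] using this

variable {G : SimpleGraph V} {g : ℕ} {Z : Finset V}

/-- Outside the core `Z` every set of size at most `g` more than doubles on adding its neighbours.
-/
theorem le_card_ball
    (hcore : ∀ X : Finset V, Disjoint X Z → X.Nonempty → #X ≤ g → #X < #(nbr G X \ (Z ∪ X)))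
    {A : Finset V} (hA : Disjoint A Z) (i : ℕ) :
    2 ^ i * #A ≤ #(ball G Z A i) ∨ g ≤ #(ball G Z A i) := by
  induction i with
  | zero => exact Or.inl (by simp [ball])
  | succ i ih =>
    have hsub : ball G Z A i ⊆ ball G Z A (i + 1) := subset_union_left
    have hmono := card_le_card hsub
    rcases Nat.lt_or_ge (#(ball G Z A i)) g with hlt | hge
    · have ih := ih.resolve_right (by omega)
      left
      rcases (ball G Z A i).eq_empty_or_nonempty with he | hne
      · rw [he, card_empty, Nat.le_zero, mul_eq_zero] at ih
        simp [ih.resolve_left (by positivity)]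
      · have h1 := hcore _ (disjoint_ball hA i) hne hlt.le
        have h2 : ball G Z A i ∪ (nbr G (ball G Z A i) \ (Z ∪ ball G Z A i)) ⊆
            ball G Z A (i + 1) :=
          union_subset_union subset_rfl (sdiff_subset_sdiff subset_rfl subset_union_left)
        have h3 := card_le_card h2
        rw [card_union_of_disjoint
          (disjoint_of_subset_left subset_union_right disjoint_sdiff)] at h3
        have : 2 ^ (i + 1) * #A = 2 * (2 ^ i * #A) := by ring
        omega
    · exact Or.inr (hge.trans hmono)

/-- The complement of a large ball shrinks by a factor of two in each step. -/
theorem card_compl_ball_le (h : EdgeBetween G g)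
    (hcore : ∀ X : Finset V, Disjoint X Z → X.Nonempty → #X ≤ g → #X < #(nbr G X \ (Z ∪ X)))
    {A : Finset V} {ρ : ℕ} (hρ : g ≤ #(ball G Z A ρ)) (i : ℕ) :
    2 ^ i * #(univ \ (Z ∪ ball G Z A (ρ + 1 + i))) ≤ g := by
  induction i with
  | zero =>
    by_contra! hcon
    obtain ⟨a, ha, b, hb, hab⟩ := h (ball G Z A ρ) (univ \ (Z ∪ ball G Z A (ρ + 1)))
      (disjoint_of_subset_left (subset_union_left.trans subset_union_right) disjoint_sdiff) hρ
      (by simpa using hcon.le)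
    simp only [mem_sdiff, mem_univ, true_and, mem_union, not_or] at hb
    exact hb.2 (mem_union_right _ (mem_sdiff.2 ⟨mem_nbr.2 ⟨a, ha, hab⟩, hb.1⟩))
  | succ i ih =>
    have hstep : 2 * #(univ \ (Z ∪ ball G Z A (ρ + 1 + i + 1))) ≤
        #(univ \ (Z ∪ ball G Z A (ρ + 1 + i))) := by
      have hmono : univ \ (Z ∪ ball G Z A (ρ + 1 + i + 1)) ⊆
          univ \ (Z ∪ ball G Z A (ρ + 1 + i)) :=
        sdiff_subset_sdiff subset_rfl (union_subset_union subset_rfl subset_union_left)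
      have hcard := card_le_card hmono
      rcases (univ \ (Z ∪ ball G Z A (ρ + 1 + i + 1))).eq_empty_or_nonempty with he | hne
      · simp [he]
      have hle : #(univ \ (Z ∪ ball G Z A (ρ + 1 + i))) ≤ g :=
        (Nat.le_mul_of_pos_left _ (by positivity)).trans ih
      have h1 := hcore _ (disjoint_of_subset_right (subset_union_left) sdiff_disjoint) hne
        (hcard.trans hle)
      -- A vertex still unreached at the next step has no neighbour in the current ball. All
      -- expansion of the unreached set therefore takes place inside the previous unreached set.
      have h2 : nbr G (univ \ (Z ∪ ball G Z A (ρ + 1 + i + 1))) \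
          (Z ∪ (univ \ (Z ∪ ball G Z A (ρ + 1 + i + 1)))) ⊆
          (univ \ (Z ∪ ball G Z A (ρ + 1 + i))) \
            (univ \ (Z ∪ ball G Z A (ρ + 1 + i + 1))) := by
        intro y hy
        obtain ⟨hy, hyn⟩ := mem_sdiff.1 hy
        rw [mem_union, not_or] at hyn
        refine mem_sdiff.2 ⟨?_, hyn.2⟩
        simp only [mem_sdiff, mem_univ, true_and, mem_union, not_or]
        refine ⟨hyn.1, fun hyb => ?_⟩
        obtain ⟨x, hx, hxy⟩ := mem_nbr.1 hy
        simp only [mem_sdiff, mem_univ, true_and, mem_union, not_or] at hx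
        exact hx.2 (mem_union_right _ (mem_sdiff.2 ⟨mem_nbr.2 ⟨y, hyb, hxy.symm⟩, hx.1⟩))
      have h3 := card_le_card h2
      rw [card_sdiff_of_subset hmono] at h3
      omega
    calc 2 ^ (i + 1) * #(univ \ (Z ∪ ball G Z A (ρ + 1 + i + 1)))
        = 2 ^ i * (2 * #(univ \ (Z ∪ ball G Z A (ρ + 1 + i + 1)))) := by ring
      _ ≤ 2 ^ i * #(univ \ (Z ∪ ball G Z A (ρ + 1 + i))) := Nat.mul_le_mul_left _ hstep
      _ ≤ g := ih

/-- Finitely many large sets have a vertex that is close to each of them. -/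
theorem exists_close_vertex (h : EdgeBetween G g) (hV : 2 * g ≤ Fintype.card V) (hZ : #Z < g)
    (hcore : ∀ X : Finset V, Disjoint X Z → X.Nonempty → #X ≤ g → #X < #(nbr G X \ (Z ∪ X)))
    {t ρ : ℕ} (A : Fin t → Finset V) (hA : ∀ a, Disjoint (A a) Z)
    (hcard : ∀ a, g ≤ 2 ^ ρ * #(A a)) :
    ∃ v, ∀ a, ∃ u ∈ A a, G.edist u v ≤ (ρ + 1 + t : ℕ) := by
  have hρ : ∀ a, g ≤ #(ball G Z (A a) ρ) := fun a =>
    (le_card_ball hcore (hA a) ρ).elim (hcard a).trans id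
  have hbad : #(univ.biUnion fun a => univ \ (Z ∪ ball G Z (A a) (ρ + 1 + t))) ≤ g := by
    refine card_biUnion_le.trans ?_
    rcases Nat.eq_zero_or_pos t with rfl | ht
    · simp
    -- Since `t ≤ 2 ^ t`, after `t` further steps each ball misses at most a `1 / t` fraction of
    -- `g`, so all the misses together number at most `g`.
    have h1 : ∀ a, t * #(univ \ (Z ∪ ball G Z (A a) (ρ + 1 + t))) ≤ g := fun a =>
      (Nat.mul_le_mul_right _ Nat.lt_two_pow_self.le).trans
        (card_compl_ball_le h hcore (hρ a) t)
    refine Nat.le_of_mul_le_mul_left ?_ ht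
    rw [mul_sum]
    refine (sum_le_card_nsmul _ _ g fun a _ => h1 a).trans ?_
    simp
  have hlt : #(Z ∪ univ.biUnion fun a => univ \ (Z ∪ ball G Z (A a) (ρ + 1 + t))) <
      #(univ : Finset V) := by
    rw [card_univ]
    exact (card_union_le _ _).trans_lt (by omega)
  obtain ⟨v, -, hv⟩ := exists_mem_notMem_of_card_lt_card hlt
  refine ⟨v, fun a => exists_edist_le_of_mem_ball (Z := Z) ?_⟩
  simp only [mem_union, mem_biUnion, mem_univ, true_and, mem_sdiff, not_or, not_exists,
    not_and, not_not] at hv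
  by_contra hcon
  exact hcon (hv.2 a hv.1)

end Balls

/-! ### Assembling the proof -/

theorem Built.verts_nonempty {V : Type*} {H : SimpleGraph V} {ℓ : ℝ} {S : H.Subgraph}
    (h : Built ℓ S) : S.verts.Nonempty := by
  cases h with
  | single x => exact ⟨x, rfl⟩
  | addLeaf S x y hS hx hy hxy => exact ⟨x, Or.inl hx⟩
  | addPath S x y hS hx => exact ⟨x, Or.inl hx⟩

open Finset in
theorem IsExpander.edgeBetween {V : Type*} [Fintype V] {G : SimpleGraph V} {ε : ℝ}
    (h : IsExpander G ε) (hε : ε ≤ 1 / 16) : EdgeBetween G (Fintype.card V / 16 + 1) := by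
  have hle : ε * (Fintype.card V : ℝ) ≤ ((Fintype.card V / 16 + 1 : ℕ) : ℝ) := by
    have h1 : Fintype.card V ≤ 16 * (Fintype.card V / 16 + 1) := by omega
    have h2 : (Fintype.card V : ℝ) ≤ 16 * ((Fintype.card V / 16 + 1 : ℕ) : ℝ) := by
      exact_mod_cast h1
    have h3 : ε * (Fintype.card V : ℝ) ≤ 1 / 16 * (Fintype.card V : ℝ) := by gcongr
    linarith
  intro A B hAB hA hB
  exact h A B hAB (hle.trans (by exact_mod_cast hA)) (hle.trans (by exact_mod_cast hB))

open Finset in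
open scoped Classical in
/-- `t` disjoint sets of size `M` in a set with at least `t M` elements. -/
theorem exists_disjoint_family {V : Type*} (U : Finset V) (t M : ℕ) (h : t * M ≤ #U) :
    ∃ A : Fin t → Finset V, (∀ a, A a ⊆ U) ∧ (∀ a, #(A a) = M) ∧
      Pairwise fun a b => Disjoint (A a) (A b) := by
  obtain ⟨e⟩ : Nonempty (Fin t × Fin M ↪ U) :=
    Function.Embedding.nonempty_of_card_le (by simpa using h)
  have hinj : ∀ {a b i j}, (e (a, i) : V) = e (b, j) → a = b ∧ i = j := fun {a b i j} he => by
    simpa using e.injective (Subtype.val_injective he)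
  refine ⟨fun a => univ.image fun i => (e (a, i) : V), fun a v hv => ?_, fun a => ?_,
    fun a b hab => ?_⟩
  · obtain ⟨i, -, rfl⟩ := mem_image.1 hv
    exact (e (a, i)).2
  · rw [card_image_of_injective _ fun i j hij => (hinj hij).2, card_univ, Fintype.card_fin]
  · refine disjoint_left.2 fun v hv hv' => ?_
    obtain ⟨i, -, rfl⟩ := mem_image.1 hv
    obtain ⟨j, -, hj⟩ := mem_image.1 hv'
    exact hab (hinj hj).1.symm

-- `D` is chosen so that `t` disjoint sets of size `κ * P`, with `κ = N / D`, fill at most half of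
-- `G`. Each of the `t * t * s` shrinking steps costs a factor `4 * d + 25`, so size at least `κ`
-- remains.
open Finset in
theorem arrows_power {s t d k n D : ℕ} (hD : D = 2 * (t + 1) * (4 * d + 25) ^ (t * (t * s)))
    (hk : 2 * (2 * D + 1 + t) ≤ k) {V W : Type*} [Fintype V] [Fintype W] {G : SimpleGraph V}
    {H : SimpleGraph W} (hV : 16 * D * n ≤ Fintype.card V) {ε : ℝ} (hε : ε ≤ 1 / 16)
    (hG : IsExpander G ε) (hbip : H.IsBipartite)
    (hH : InFamily n d (2 * Real.logb 2 (Fintype.card V : ℝ)) H) :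
    Arrows (power G k) t s H := by
  classical
  obtain ⟨hn, hd, hbuilt⟩ := hH
  obtain ⟨x₀, -⟩ := hbuilt.verts_nonempty
  have hn0 : 0 < n := hn ▸ Fintype.card_pos_iff.2 ⟨x₀⟩
  obtain ⟨c₂⟩ := hbip
  let c : H.Coloring Bool := SimpleGraph.Coloring.mk (fun x => decide (c₂ x = 0)) fun {x y} hxy => by
    have := c₂.valid hxy
    rw [ne_eq, decide_eq_decide]
    omega
  set P := (4 * d + 25) ^ (t * (t * s)) with hP
  have hP0 : 0 < P := by positivity
  have hD0 : 0 < D := by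
    rw [hD]
    positivity
  set N := Fintype.card V with hN
  have hDn : D ≤ D * n := Nat.le_mul_of_pos_right _ hn0
  rw [mul_assoc] at hV
  obtain ⟨κ, hκdef⟩ : ∃ κ, κ = N / D := ⟨_, rfl⟩
  have hnκ : n ≤ κ := by
    rw [hκdef, Nat.le_div_iff_mul_le hD0, mul_comm]
    omega
  have hκD : D * κ ≤ N := hκdef ▸ Nat.mul_div_le N D
  have hNκ : N < D * κ + D := by
    rw [hκdef]
    exact Nat.lt_mul_div_succ N hD0
  have hDκ : D ≤ D * κ := Nat.le_mul_of_pos_right _ (by omega)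
  have hedge := hG.edgeBetween hε
  rw [← hN] at hedge
  obtain ⟨Z, hZ, hcore⟩ := hedge.exists_core (by omega)
  have htM : 2 * (t * (κ * P)) ≤ D * κ := by
    rw [hD, show 2 * (t + 1) * P * κ = 2 * (t * (κ * P)) + 2 * (κ * P) by ring]
    exact Nat.le_add_right _ _
  obtain ⟨A, hAZ, hAcard, hAdisj⟩ := exists_disjoint_family (univ \ Z) t (κ * P) (by
    have h1 := le_card_sdiff Z univ
    rw [card_univ, ← hN] at h1
    omega)
  intro C
  rcases isContained_or_exists_family (fun i : Fin s => C.labelGraph i.succ) hd c hbuilt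
    -- From `2 ^ (j + 2) ≤ N` follows `2 * j + 4 ≤ 2 log N`, one more than needed.
    (fun j hj => by
      have h1 : ((2 : ℝ) ^ ((j + 2 : ℕ) : ℝ)) ≤ (N : ℝ) := by
        rw [Real.rpow_natCast]
        exact_mod_cast hj
      have h2 := (Real.le_logb_iff_rpow_le one_lt_two
        (by exact_mod_cast (by omega : 0 < N))).2 h1
      push_cast at h2 ⊢
      linarith)
    (by omega : 0 < κ) (hn.trans_le hnκ) univ A hAdisj
    (fun a => by
      rw [hAcard, card_univ, Fintype.card_prod, Fintype.card_prod, Fintype.card_fin,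
        Fintype.card_fin]) with h | ⟨A', hsub, hcard, hno⟩
  · exact Or.inr h
  left
  -- Since `N < 2 * D * κ` and `2 * D ≤ 2 ^ (2 * D)`, a set of size `κ` grows to size `g` within `2
  -- * D` doublings, a radius independent of `n`.
  have hclose := exists_close_vertex (ρ := 2 * D) hedge (by omega) hZ hcore A'
    (fun a => disjoint_of_subset_left ((hsub a).trans (hAZ a)) sdiff_disjoint)
    (fun a => by
      have h1 : 2 * D * κ ≤ 2 ^ (2 * D) * #(A' a) :=
        Nat.mul_le_mul Nat.lt_two_pow_self.le (hcard a)
      have h2 : 2 * D * κ = D * κ + D * κ := by ring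
      omega)
  obtain ⟨v, hv⟩ := hclose
  choose u hu huv using hv
  have hne : ∀ a b, a ≠ b → u a ≠ u b := fun a b hab he =>
    disjoint_left.1 (hAdisj hab) (hsub a (hu a)) (he ▸ hsub b (hu b))
  refine ⟨⟨⟨u, fun {a b} hab => ?_⟩, fun a b he => by_contra fun hab => hne a b hab he⟩⟩
  have hab : a ≠ b := hab
  have hadj : (power G k).Adj (u a) (u b) := by
    refine ⟨hne a b hab, (SimpleGraph.edist_triangle (v := v)).trans ?_⟩
    have h1 := huv b
    rw [SimpleGraph.edist_comm] at h1
    refine (add_le_add (huv a) h1).trans ?_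
    exact_mod_cast (by omega : (2 * D + 1 + t) + (2 * D + 1 + t) ≤ k)
  rw [SimpleGraph.EdgeLabeling.labelGraph_adj]
  refine ⟨hadj, ?_⟩
  by_contra h0
  obtain ⟨i, hi⟩ := Fin.exists_succ_eq.2 h0
  exact hno a b i (mem_univ _) hab _ (hu a) _ (hu b)
    ((SimpleGraph.EdgeLabeling.labelGraph_adj _ _).2 ⟨hadj, hi.symm⟩)

end ExpanderRamsey

theorem mainTheorem9 :
    ∃ ε₀ : ℝ, 0 < ε₀ ∧
      ∀ s t d : ℕ, ∃ k₀ : ℕ, ∀ k : ℕ, k₀ ≤ k →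
        ∃ α₀ : ℝ, ∀ α : ℝ, α₀ ≤ α →
          ∀ ε : ℝ, 0 < ε → ε ≤ ε₀ → ∀ n : ℕ,
            ∀ (V : Type*) [Fintype V] (G : SimpleGraph V),
              (Fintype.card V : ℝ) = α * (n : ℝ) → ExpanderRamsey.IsExpander G ε →
              ∀ (W : Type*) [Fintype W] (H : SimpleGraph W),
                H.IsBipartite →
                ExpanderRamsey.InFamily n d (2 * Real.logb 2 (α * (n : ℝ))) H →
                ExpanderRamsey.Arrows (ExpanderRamsey.power G k) t s H := by
  refine ⟨1 / 16, by norm_num, fun s t d => ?_⟩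
  obtain ⟨D, hD⟩ : ∃ D, D = 2 * (t + 1) * (4 * d + 25) ^ (t * (t * s)) := ⟨_, rfl⟩
  -- `k₀` is twice the radius `2 * D + 1 + t`, because two vertices of the clique are linked through
  -- the common close vertex.
  refine ⟨2 * (2 * D + 1 + t), fun k hk => ⟨(16 * D : ℕ), ?_⟩⟩
  intro α hα ε _ hε n V _ G hV hG W _ H hbip hH
  rw [← hV] at hH
  refine ExpanderRamsey.arrows_power hD hk ?_ hε hG hbip hH
  have h1 : ((16 * D : ℕ) : ℝ) * n ≤ Fintype.card V := by
    rw [hV]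
    gcongr
  exact_mod_cast h1
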